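/- **Setting.** All segments are straight segments in the plane with two distinct endpoints. Two segments *cross* if they meet in a single point that is an endpoint of neither. Let $P=C\cup\{q\}$ with $q\notin C$ be a finite set of points, no three collinear, with $C$ in convex position (no point of $C$ lies in the convex hull of the others; $q$ may be anywhere). Let $\Gamma$ be one of the following properties of a finite multiset $S$ of segments with endpoints in $P$, seen as a multigraph on $P$: $\mathsf{Multigraph}$ (no restriction), $\mathsf{Cycle}$ (Hamiltonian cycle, i.e. a TSP tour), $\mathsf{Tree}$ (spanning tree), $\mathsf{Matching}$ (perfect matching), $\mathsf{RedBlue}$ (the points are coloured red or blue; perfect matching in which every segment joins a red and a blue point). A *flip* removes two crossing segments of $S$ and inserts two non-crossing segments with the same four endpoints, the four segments forming a cycle, such that $\Gamma$ is preserved. The vertices of the flip graph $F(P,n,\Gamma)$ are the multisets of $n$ segments with endpoints in $P$ that satisfy $\Gamma$, and its arcs are the flips. A *removal strategy* $R$ chooses for every vertex $S$ with crossings a pair of crossing segments of $S$ that some flip of $S$ removes, and keeps exactly the flips of $S$ that remove this pair; so a path in $R$ can be continued until it reaches a crossing-free multiset. Let $D^R_{\mathsf{Convex},\Gamma}(n)$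 be the maximum over all point sets $Q$ in convex position (with any colouring) and all $m\le n$ of the minimum over all removal strategies $R$ for $F(Q,m,\Gamma)$ of the length of the longest path in $R$. Let $\widetilde D^R_{\mathsf{Convex},\Gamma}(n)$ be the analogous number for untangling a *part* of a multiset with property $\Gamma$: the maximum over all $m\le n$, all finite point sets $P'$ without three collinear points (with any colouring), all $Q\subseteq P'$ in convex position and all multisets $B$ of segments, of the minimum over all removal strategies of the length of the longest flip sequence on multisets $A$ of segments with endpoints in $Q$ such that $A+B$ has $m$ segments, with endpoints in $P'$, and satisfies $\Gamma$; here only crossing pairs of segments of $A$ are flipped, $B$ stays fixed, and the flips must preserve $\Gamma$ for $A+B$. **Theorem.** There is an absolute constant $K$ such that for all $C$, $q$, $\Gamma$ (and colourings) as above and all $n\ge 0$ there is a removal strategy $R$ for $F(P,n,\Gamma)$ with the following properties. Let $S$ be any multiset of $n$ segments with endpoints in $P$ that satisfies $\Gamma$, and let $t$ be the degree of $q$ in $S$. Then every flip sequence in $R$ that starts from $S$ (in particular every untangle sequence) has length at most 1. $t(n-1)+\widetilde D^R_{\mathsf{Convex},\Gamma}(n)$; 2. $t(n-1)+D^R_{\mathsf{Convex},\Gamma}(n)$,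 if $\Gamma\in\{\mathsf{Multigraph},\mathsf{Matching},\mathsf{RedBlue}\}$ or $t\le 1$; 3. $K\,(n\log(2+|C|)+tn)$ and $K\,(n\log(2+n)+tn)$, for every $\Gamma$, in particular for multigraphs; 4. $K\,tn$, if $\Gamma\in\{\mathsf{Cycle},\mathsf{RedBlue}\}$; 5. $t(n-1)$, if no two segments of $S$ with both endpoints in $C$ cross each other. -/

import Mathlib

namespace Untangle

/-- Points of the plane. Only affine notions (segments, collinearity, convexity) are used. -/
abbrev Pt : Type := ℝ × ℝ

/-- A segment, given by its unordered pair of endpoints. -/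
abbrev Seg : Type := Sym2 Pt

/-- The set of points of the plane covered by a segment. -/
def Seg.pts (s : Seg) : Set Pt := convexHull ℝ {p : Pt | p ∈ s}

/-- Two segments cross if they intersect at a single point,
which is not an endpoint of either segment. -/
def Cross (s₁ s₂ : Seg) : Prop :=
  ∃ x : Pt, Seg.pts s₁ ∩ Seg.pts s₂ = {x} ∧ x ∉ s₁ ∧ x ∉ s₂

/-- No three distinct points of `P` are collinear. -/
def GeneralPosition (P : Finset Pt) : Prop :=
  ∀ a ∈ P, ∀ b ∈ P, ∀ c ∈ P, a ≠ b → b ≠ c → a ≠ c → ¬ Collinear ℝ {a, b, c}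

/-- The points of `C` are in convex position: none of them is in the convex hull of the others. -/
def ConvexPosition (C : Finset Pt) : Prop :=
  ConvexIndependent ℝ (fun p : {p // p ∈ C} => (p : Pt))

open Classical in
/-- The degree of `p` in the multigraph whose edges are the segments of `S`
(none of which is a loop). -/
noncomputable def degree (p : Pt) (S : Multiset Seg) : ℕ :=
  Multiset.card (S.filter (fun s => p ∈ s))

/-- The simple graph on the vertex set `P` underlying the multiset of segments `S`. -/
def graphOn (P : Finset Pt) (S : Multiset Seg) : SimpleGraph {p // p ∈ P} where
  Adj a b := a ≠ b ∧ s((a : Pt), (b : Pt)) ∈ S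
  symm := ⟨fun a b h => ⟨h.1.symm, by rw [Sym2.eq_swap]; exact h.2⟩⟩
  loopless := ⟨fun _ h => h.1 rfl⟩

/-- The graph properties. -/
inductive GraphProperty : Type
  | multigraph
  | cycle
  | tree
  | matching
  | redBlue

/-- `S` is a Hamiltonian cycle on the vertex set `P`: its segments join the cyclically consecutive
entries of a list that enumerates `P` without repetition. -/
def IsHamCycle (P : Finset Pt) (S : Multiset Seg) : Prop :=
  ∃ l : List Pt, l.Nodup ∧ 3 ≤ l.length ∧ (∀ p, p ∈ l ↔ p ∈ P) ∧
    S = ((List.zipWith (fun a b => s(a, b)) l (l.rotate 1) : List Seg) : Multiset Seg)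

/-- `S` is a spanning tree on the vertex set `P`. -/
def IsSpanningTree (P : Finset Pt) (S : Multiset Seg) : Prop :=
  S.Nodup ∧ (graphOn P S).IsTree

/-- `S` is a perfect matching of `P`. -/
def IsPerfectMatching (P : Finset Pt) (S : Multiset Seg) : Prop :=
  ∀ p ∈ P, degree p S = 1

/-- The multigraph `(P, S)` has the property `Γ`. The colouring `col` (`true` is red, `false` is
blue) only matters for red-blue matchings. -/
def Satisfies (P : Finset Pt) (col : Pt → Bool) (S : Multiset Seg) : GraphProperty → Prop
  | .multigraph => True
  | .cycle => IsHamCycle P S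
  | .tree => IsSpanningTree P S
  | .matching => IsPerfectMatching P S
  | .redBlue => IsPerfectMatching P S ∧
      ∀ s ∈ S, ∃ a b : Pt, s = s(a, b) ∧ col a = true ∧ col b = false

/-- The vertices of the flip graph `F(P, n, Γ)`: multisets of `n` segments with
(distinct) endpoints in `P` that satisfy `Γ`. -/
def IsState (Γ : GraphProperty) (P : Finset Pt) (col : Pt → Bool) (n : ℕ)
    (S : Multiset Seg) : Prop :=
  Multiset.card S = n ∧ (∀ s ∈ S, ¬ s.IsDiag ∧ ∀ p ∈ s, p ∈ P) ∧ Satisfies P col S Γ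

/-- The pair `e` is a pair of crossing segments of `S`. -/
def IsCrossing (S : Multiset Seg) (e : Seg × Seg) : Prop :=
  Cross e.1 e.2 ∧ e.1 ∈ S ∧ e.2 ∈ S

/-- `S'` is obtained from `S` by a flip that removes the pair of crossing segments `e` and inserts
two non-crossing segments such that the four segments form a cycle `a b d c`. Both `S` and `S'` must
belong to the class `V` of admissible multisets of segments. As `a, b` and `c, d` may be exchanged,
the two possible insertions are covered. -/
def FlipAt (V : Multiset Seg → Prop) (e : Seg × Seg) (S S' : Multiset Seg) : Prop :=
  V S ∧ V S' ∧ Cross e.1 e.2 ∧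
    ∃ (a b c d : Pt) (U : Multiset Seg), e.1 = s(a, b) ∧ e.2 = s(c, d) ∧
      ¬ Cross s(a, c) s(b, d) ∧
      S = s(a, b) ::ₘ s(c, d) ::ₘ U ∧ S' = s(a, c) ::ₘ s(b, d) ::ₘ U

/-- A removal strategy on the flip graph with vertex class `V`, given by the crossing pair `ρ S`
removed at each vertex `S`. The arcs of the strategy that leave `S` are all the flips
of `S` that remove the pair `ρ S`; every vertex with crossings has such an arc, so the sinks are
exactly the crossing-free vertices. -/
def IsRemovalStrategy (V : Multiset Seg → Prop) (ρ : Multiset Seg → Seg × Seg) : Prop :=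
  ∀ S, V S → (∃ e, IsCrossing S e) → IsCrossing S (ρ S) ∧ ∃ S', FlipAt V (ρ S) S S'

/-- There is a flip sequence of `k` flips in the removal strategy `ρ` that starts from `S`. -/
def HasFlipSeq (V : Multiset Seg → Prop) (ρ : Multiset Seg → Seg × Seg)
    (S : Multiset Seg) (k : ℕ) : Prop :=
  ∃ σ : ℕ → Multiset Seg, σ 0 = S ∧ ∀ i < k, FlipAt V (ρ (σ i)) (σ i) (σ (i + 1))

/-- The length of the longest flip sequence in the removal strategy `ρ`. -/
noncomputable def longest (V : Multiset Seg → Prop) (ρ : Multiset Seg → Seg × Seg) : ℕ∞ :=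
  ⨆ (S : Multiset Seg) (_ : V S) (k : ℕ) (_ : HasFlipSeq V ρ S k), (k : ℕ∞)

/-- The minimum over all removal strategies of the length of the longest flip sequence. -/
noncomputable def removalValue (V : Multiset Seg → Prop) : ℕ∞ :=
  ⨅ (ρ : Multiset Seg → Seg × Seg) (_ : IsRemovalStrategy V ρ), longest V ρ

/-- The number of flips needed, with removal choice, to untangle any multiset of at most `n`
segments that has the property `Γ` and whose endpoints are in convex position. -/
noncomputable def convexR (Γ : GraphProperty) (n : ℕ) : ℕ∞ :=
  ⨆ (m : ℕ) (_ : m ≤ n) (Q : Finset Pt) (_ : ConvexPosition Q) (col : Pt → Bool),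
    removalValue (IsState Γ Q col m)

/-- The number of flips needed, with removal choice, to untangle any multiset `A` of segments with
endpoints in convex position which is a part of a multiset `A + B` of at most `n` segments that has
the property `Γ`. Only segments of `A` are flipped, and the flips must preserve the property `Γ` of
the whole multiset `A + B`. -/
noncomputable def convexPartR (Γ : GraphProperty) (n : ℕ) : ℕ∞ :=
  ⨆ (m : ℕ) (_ : m ≤ n) (P : Finset Pt) (_ : GeneralPosition P) (col : Pt → Bool)
    (Q : Finset Pt) (_ : Q ⊆ P) (_ : ConvexPosition Q) (B : Multiset Seg),
    removalValue (fun A => IsState Γ P col m (A + B) ∧ ∀ s ∈ A, ∀ p ∈ s, p ∈ Q)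

end Untangle

/-!
Call the segments of `S` at `q` spokes and the other ones, whose endpoints are in convex position,
chords. Two spokes never cross. The removal strategy has two phases.

In the first phase only chords are flipped, while the spokes stay fixed. For every multiset `B` of
spokes an optimal strategy for the chords is used (`exists_optimal_strategy`), so that the length of
this phase is at most the value `removalValue (PartState Γ P col n C B)` of the corresponding game.
By definition this is at most `convexPartR Γ n`, and it is at most `convexR Γ n` if the chords have
the property `Γ` themselves on a subset of `C` (`removalValue_partState_le_convexR`).

The explicit bounds on this value come from a potential, the number of crossed chords: an uncrossed
chord stays uncrossed for ever, since the two sides of it do not interact. Take a crossed chord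
`a c` that spans a minimal interval of the points along the hull (`Ear`), so that the chords within
this interval are uncrossed. Every chord `b d` crossing it has exactly one endpoint `b` in the
interval, and flipping `a c` with `b d` replaces `a c` by `a b` or `b c`, which cuts off a smaller
ear, pierced only by chords that pierced the old one. If `b` is the median of the inner endpoints,
their number is halved, so that logarithmically many flips produce an uncrossed chord
(`Ear.winTo_of_card_lt`). For red-blue matchings and tours the removed pair determines the inserted
one, by the colours or by the direction in which the tour runs through `b d`, and a suitable choice
of `b` produces an uncrossed chord within two or three flips (`removalValue_redBlue_le`,
`Ear.winTo_cycle_three`).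

In the second phase the chords are crossing-free. Among the chords crossing a spoke `q p`, the one
nearest to `p` is removed together with `q p`; then the inserted chord crosses no other chord
(`exists_nearest_chord`). The potential is the number of pairs of a spoke and a chord such that the
line through the chord strictly separates the endpoints of the spoke. It decreases with every flip
(`separations_flip_lt`), and with `t` spokes it is at most
`t * (n - t)`.
-/

namespace Untangle

/-! ### Orientation and crossings -/

/-- Twice the signed area of the triangle `a b c`: it is positive if the triangle is oriented
counterclockwise. -/
def orient (a b c : Pt) : ℝ := (b.1 - a.1) * (c.2 - a.2) - (b.2 - a.2) * (c.1 - a.1)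

lemma orient_swap (a b c : Pt) : orient b a c = -orient a b c := by
  unfold orient; ring

lemma orient_rotate (a b c : Pt) : orient b c a = orient a b c := by
  unfold orient; ring

lemma orient_self_left (a b : Pt) : orient a b a = 0 := by
  unfold orient; ring

lemma orient_self_right (a b : Pt) : orient a b b = 0 := by
  unfold orient; ring

lemma orient_self (a b : Pt) : orient a a b = 0 := by
  unfold orient; ring

/-- The signed area is an affine function of the third point. -/
lemma orient_affine {u v q p c d : Pt} {α β γ : ℝ} (h : α + β + γ = 1)
    (hq : q = α • p + β • c + γ • d) :
    orient u v q = α * orient u v p + β * orient u v c + γ * orient u v d := by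
  subst hq
  have hα : α = 1 - β - γ := by linarith
  subst hα
  simp only [orient, Prod.fst_add, Prod.snd_add, Prod.smul_fst, Prod.smul_snd, smul_eq_mul]
  ring

lemma collinear_of_orient_eq_zero {a b c : Pt} (hab : a ≠ b) (h : orient a b c = 0) :
    Collinear ℝ {a, b, c} := by
  rw [collinear_iff_of_mem (p₀ := a) (by simp)]
  refine ⟨b - a, ?_⟩
  have key : ∃ r : ℝ, c = r • (b - a) + a := by
    unfold orient at h
    by_cases h1 : b.1 - a.1 = 0
    · have h2 : b.2 - a.2 ≠ 0 := fun h2 => hab (Prod.ext (by linarith) (by linarith))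
      have h3 : c.1 - a.1 = 0 := by
        rw [h1, zero_mul, zero_sub, neg_eq_zero] at h
        exact (mul_eq_zero.1 h).resolve_left h2
      refine ⟨(c.2 - a.2) / (b.2 - a.2), Prod.ext ?_ ?_⟩
      · simp [h1]; linarith
      · simp; field_simp; ring
    · refine ⟨(c.1 - a.1) / (b.1 - a.1), Prod.ext ?_ ?_⟩
      · simp; field_simp; ring
      · simp; field_simp; linarith
  intro p hp
  simp only [Set.mem_insert_iff, Set.mem_singleton_iff] at hp
  rcases hp with rfl | rfl | rfl
  · exact ⟨0, by simp⟩
  · exact ⟨1, by simp⟩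
  · simpa using key

lemma GeneralPosition.orient_ne_zero {P : Finset Pt} (hP : GeneralPosition P) {a b c : Pt}
    (ha : a ∈ P) (hb : b ∈ P) (hc : c ∈ P) (hab : a ≠ b) (hbc : b ≠ c) (hac : a ≠ c) :
    orient a b c ≠ 0 :=
  fun h => hP a ha b hb c hc hab hbc hac (collinear_of_orient_eq_zero hab h)

lemma GeneralPosition.mono {P Q : Finset Pt} (hP : GeneralPosition P) (h : Q ⊆ P) :
    GeneralPosition Q :=
  fun a ha b hb c hc => hP a (h ha) b (h hb) c (h hc)

lemma ConvexPosition.mono {C Q : Finset Pt} (hC : ConvexPosition C) (h : Q ⊆ C) :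
    ConvexPosition Q :=
  ConvexIndependent.mono (t := (C : Set Pt)) (s := (Q : Set Pt)) hC (by exact_mod_cast h)

lemma Seg.pts_mk (a b : Pt) : Seg.pts s(a, b) = segment ℝ a b := by
  unfold Seg.pts
  rw [← convexHull_pair]
  congr 1
  ext p
  simp

lemma Cross.symm {s₁ s₂ : Seg} (h : Cross s₁ s₂) : Cross s₂ s₁ := by
  obtain ⟨x, hx, h1, h2⟩ := h
  exact ⟨x, by rw [Set.inter_comm, hx], h2, h1⟩

/-- A common endpoint would be the only common point of the two segments. -/
lemma Cross.disjoint {s₁ s₂ : Seg} (h : Cross s₁ s₂) {p : Pt} (h₁ : p ∈ s₁) : p ∉ s₂ := by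
  obtain ⟨x, hx, h1, h2⟩ := h
  intro h₂
  have : p ∈ Seg.pts s₁ ∩ Seg.pts s₂ :=
    ⟨subset_convexHull ℝ _ h₁, subset_convexHull ℝ _ h₂⟩
  rw [hx] at this
  rw [Set.mem_singleton_iff] at this
  exact h1 (this ▸ h₁)

lemma not_cross_self (s : Seg) : ¬ Cross s s := by
  induction s using Sym2.ind with
  | _ a b => exact fun h => h.disjoint (Sym2.mem_mk_left a b) (Sym2.mem_mk_left a b)

/-- The crossing point is a proper convex combination of the endpoints of both segments. -/
lemma Cross.exists_point {a b c d : Pt} (h : Cross s(a, b) s(c, d)) :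
    ∃ s r : ℝ, 0 < s ∧ s < 1 ∧ 0 < r ∧ r < 1 ∧ (1 - s) • a + s • b = (1 - r) • c + r • d := by
  obtain ⟨x, hx, h1, h2⟩ := h
  have hx' : x ∈ Seg.pts s(a, b) ∩ Seg.pts s(c, d) := by rw [hx]; rfl
  rw [Seg.pts_mk, Seg.pts_mk, segment_eq_image, segment_eq_image] at hx'
  obtain ⟨⟨s, ⟨hs0, hs1⟩, hs⟩, ⟨r, ⟨hr0, hr1⟩, hr⟩⟩ := hx'
  simp only [Sym2.mem_iff, not_or] at h1 h2
  simp only at hs hr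
  refine ⟨s, r, lt_of_le_of_ne hs0 ?_, lt_of_le_of_ne hs1 ?_, lt_of_le_of_ne hr0 ?_,
    lt_of_le_of_ne hr1 ?_, hs.trans hr.symm⟩
  · rintro rfl; exact h1.1 (by rw [← hs]; simp)
  · rintro rfl; exact h1.2 (by rw [← hs]; simp)
  · rintro rfl; exact h2.1 (by rw [← hr]; simp)
  · rintro rfl; exact h2.2 (by rw [← hr]; simp)

/-- The endpoints of two crossing segments are four distinct points. -/
lemma Cross.ne {a b c d : Pt} (h : Cross s(a, b) s(c, d)) :
    a ≠ b ∧ c ≠ d ∧ a ≠ c ∧ a ≠ d ∧ b ≠ c ∧ b ≠ d := by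
  have ha := h.disjoint (Sym2.mem_mk_left a b)
  have hb := h.disjoint (Sym2.mem_mk_right a b)
  simp only [Sym2.mem_iff, not_or] at ha hb
  refine ⟨?_, ?_, ha.1, ha.2, hb.1, hb.2⟩
  · rintro rfl
    obtain ⟨x, hx, h1, h2⟩ := h
    have hx' : x ∈ Seg.pts s(a, a) ∩ Seg.pts s(c, d) := by rw [hx]; rfl
    rw [Seg.pts_mk, segment_same] at hx'
    exact h1 (by rw [hx'.1]; simp)
  · rintro rfl
    obtain ⟨x, hx, h1, h2⟩ := h
    have hx' : x ∈ Seg.pts s(a, b) ∩ Seg.pts s(c, c) := by rw [hx]; rfl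
    rw [Seg.pts_mk, Seg.pts_mk, segment_same] at hx'
    exact h2 (by rw [hx'.2]; simp)

lemma Cross.orient_mul_neg {P : Finset Pt} (hP : GeneralPosition P) {a b c d : Pt} (ha : a ∈ P)
    (hb : b ∈ P) (hc : c ∈ P) (h : Cross s(a, b) s(c, d)) :
    orient a b c * orient a b d < 0 := by
  obtain ⟨s, r, hs0, hs1, hr0, hr1, he⟩ := h.exists_point
  obtain ⟨hab, hcd, hac, had, hbc, hbd⟩ := h.ne
  have h1 := hP.orient_ne_zero ha hb hc hab hbc hac
  have h2 : (1 - r) * orient a b c + r * orient a b d = 0 := by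
    have e1 := orient_affine (u := a) (v := b) (p := a) (c := a) (d := b)
      (q := (1 - s) • a + s • b) (α := 0) (β := 1 - s) (γ := s) (by ring) (by simp)
    have e2 := orient_affine (u := a) (v := b) (p := a) (c := c) (d := d)
      (q := (1 - s) • a + s • b) (α := 0) (β := 1 - r) (γ := r) (by ring) (by simp [he])
    rw [orient_self_left, orient_self_right] at e1
    rw [orient_self_left] at e2
    linarith
  have h3 : orient a b c * orient a b d = -((1 - r) / r * orient a b c ^ 2) := by
    have : orient a b d = -((1 - r) / r * orient a b c) := by
      field_simp
      linarith
    rw [this]; ring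
  rw [h3, neg_lt_zero]
  have : 0 < 1 - r := by linarith
  positivity

/-- Two segments whose supporting lines separate the endpoints of the other segment cross. -/
lemma cross_of_orient {a b c d : Pt} (h1 : orient a b c * orient a b d < 0)
    (h2 : orient c d a * orient c d b < 0) : Cross s(a, b) s(c, d) := by
  have par {x y : ℝ} (h : x * y < 0) : x - y ≠ 0 ∧ 0 < x / (x - y) ∧ x / (x - y) < 1 := by
    rcases mul_neg_iff.1 h with ⟨hx, hy⟩ | ⟨hx, hy⟩
    · have : 0 < x - y := by linarith
      exact ⟨this.ne', by positivity, by rw [div_lt_one this]; linarith⟩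
    · have : x - y < 0 := by linarith
      exact ⟨this.ne, div_pos_of_neg_of_neg hx this, by rw [div_lt_one_of_neg this]; linarith⟩
  obtain ⟨n1, r0, r1⟩ := par h1
  obtain ⟨n2, s0, s1⟩ := par h2
  have hw : orient c d a - orient c d b = -(orient a b c - orient a b d) := by
    unfold orient; ring
  set r := orient a b c / (orient a b c - orient a b d) with hr
  set s := orient c d a / (orient c d a - orient c d b) with hs
  have hx : (1 - s) • a + s • b = (1 - r) • c + r • d := by
    have hr' : r * (orient a b c - orient a b d) = orient a b c := by rw [hr]; field_simp
    have hs' : s * (orient a b c - orient a b d) = -orient c d a := by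
      have : s * (orient c d a - orient c d b) = orient c d a := by rw [hs]; field_simp
      rw [hw] at this; linarith
    clear_value r s
    refine Prod.ext ?_ ?_
    · simp only [Prod.fst_add, Prod.smul_fst, smul_eq_mul]
      apply mul_left_cancel₀ n1
      have : (orient a b c - orient a b d) * a.1 - orient c d a * (b.1 - a.1) =
          (orient a b c - orient a b d) * c.1 + orient a b c * (d.1 - c.1) := by
        unfold orient; ring
      linear_combination this + (b.1 - a.1) * hs' - (d.1 - c.1) * hr'
    · simp only [Prod.snd_add, Prod.smul_snd, smul_eq_mul]
      apply mul_left_cancel₀ n1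
      have : (orient a b c - orient a b d) * a.2 - orient c d a * (b.2 - a.2) =
          (orient a b c - orient a b d) * c.2 + orient a b c * (d.2 - c.2) := by
        unfold orient; ring
      linear_combination this + (b.2 - a.2) * hs' - (d.2 - c.2) * hr'
  have hxab : orient a b ((1 - s) • a + s • b) = 0 := by
    rw [orient_affine (u := a) (v := b) (p := a) (c := a) (d := b)
      (α := 0) (β := 1 - s) (γ := s) (by ring) (by simp)]
    simp [orient_self_left, orient_self_right]
  have hxcd : orient c d ((1 - s) • a + s • b) = 0 := by
    rw [hx, orient_affine (u := c) (v := d) (p := c) (c := c) (d := d)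
      (α := 0) (β := 1 - r) (γ := r) (by ring) (by simp)]
    simp [orient_self_left, orient_self_right]
  refine ⟨(1 - s) • a + s • b, ?_, ?_, ?_⟩
  · rw [Seg.pts_mk, Seg.pts_mk]
    ext z
    rw [Set.mem_singleton_iff]
    constructor
    · rintro ⟨hz1, hz2⟩
      rw [segment_eq_image] at hz1 hz2
      obtain ⟨s', -, rfl⟩ := hz1
      obtain ⟨r', -, hz⟩ := hz2
      simp only at hz
      have e1 := orient_affine (u := a) (v := b) (p := a) (c := a) (d := b)
        (q := (1 - s') • a + s' • b) (α := 0) (β := 1 - s') (γ := s') (by ring) (by simp)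
      have e2 := orient_affine (u := a) (v := b) (p := a) (c := c) (d := d)
        (q := (1 - s') • a + s' • b) (α := 0) (β := 1 - r') (γ := r') (by ring) (by simp [hz])
      rw [orient_self_left, orient_self_right] at e1
      rw [orient_self_left] at e2
      have : r' = r := by
        rw [hr, eq_div_iff n1]; linarith
      change (1 - s') • a + s' • b = _
      rw [← hz, hx, this]
    · rintro rfl
      refine ⟨?_, ?_⟩
      · rw [segment_eq_image]; exact ⟨s, ⟨s0.le, s1.le⟩, rfl⟩
      · rw [hx, segment_eq_image]; exact ⟨r, ⟨r0.le, r1.le⟩, rfl⟩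
  · rw [Sym2.mem_iff]
    rintro (h | h)
    · rw [h] at hxcd; rw [hxcd] at h2; simp at h2
    · rw [h] at hxcd; rw [hxcd] at h2; simp at h2
  · rw [Sym2.mem_iff]
    rintro (h | h)
    · rw [h] at hxab; rw [hxab] at h1; simp at h1
    · rw [h] at hxab; rw [hxab] at h1; simp at h1

/-- The segments inserted by a flip are opposite sides of a convex quadrilateral. -/
lemma Cross.not_cross {P : Finset Pt} (hP : GeneralPosition P) {a b c d : Pt} (ha : a ∈ P)
    (hb : b ∈ P) (hc : c ∈ P) (hd : d ∈ P) (h : Cross s(a, b) s(c, d)) :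
    ¬ Cross s(a, c) s(b, d) := by
  intro h'
  have e1 := h.orient_mul_neg hP ha hb hc
  have e2 := h.symm.orient_mul_neg hP hc hd ha
  have e3 := h'.orient_mul_neg hP ha hc hb
  have e4 := h'.symm.orient_mul_neg hP hb hd ha
  have i1 : orient a c b = - orient a b c := by unfold orient; ring
  have i2 : orient b d a = orient a b d := by unfold orient; ring
  have i3 : orient b d c = - orient c d b := by unfold orient; ring
  have i4 : orient c d a = orient a c d := by unfold orient; ring
  have i5 : orient a b c + orient a c d = orient a b d + orient c d b := by unfold orient; ring
  rw [i4] at e2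
  rw [i1] at e3
  rw [i2, i3] at e4
  rcases mul_neg_iff.1 e1 with ⟨x1, x2⟩ | ⟨x1, x2⟩ <;>
  rcases mul_neg_iff.1 e2 with ⟨x3, x4⟩ | ⟨x3, x4⟩ <;> nlinarith

/-- In convex position, no point lies in a triangle spanned by three others. -/
lemma ConvexPosition.not_mem_triangle {C : Finset Pt} (hC : ConvexPosition C) {o x y z : Pt}
    (ho : o ∈ C) (hx : x ∈ C) (hy : y ∈ C) (hz : z ∈ C) (hxy : 0 < orient o x y)
    (hyz : 0 < orient o y z) : ¬ 0 < orient o z x := by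
  intro hzx
  have hox : o ≠ x := by rintro rfl; rw [orient_self] at hxy; exact lt_irrefl _ hxy
  have hoy : o ≠ y := by rintro rfl; rw [orient_self] at hyz; exact lt_irrefl _ hyz
  have hoz : o ≠ z := by rintro rfl; rw [orient_self] at hzx; exact lt_irrefl _ hzx
  have h := (convexIndependent_set_iff_notMem_convexHull_sdiff (𝕜 := ℝ) (s := (C : Set Pt))).1 hC
    o ho
  apply h
  set w := orient o x y + orient o y z + orient o z x with hw
  have hw0 : 0 < w := by positivity
  have hsub : ({x, y, z} : Set Pt) ⊆ (C : Set Pt) \ {o} := by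
    intro p hp
    simp only [Set.mem_insert_iff, Set.mem_singleton_iff] at hp
    rcases hp with rfl | rfl | rfl
    · exact ⟨hx, fun h => hox h.symm⟩
    · exact ⟨hy, fun h => hoy h.symm⟩
    · exact ⟨hz, fun h => hoz h.symm⟩
  refine convexHull_mono hsub ?_
  have hcv := convex_convexHull ℝ ({x, y, z} : Set Pt)
  have hx' : x ∈ convexHull ℝ ({x, y, z} : Set Pt) := subset_convexHull ℝ _ (by simp)
  have hy' : y ∈ convexHull ℝ ({x, y, z} : Set Pt) := subset_convexHull ℝ _ (by simp)
  have hz' : z ∈ convexHull ℝ ({x, y, z} : Set Pt) := subset_convexHull ℝ _ (by simp)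
  have he : o = (orient o y z / w) • x + (orient o z x / w) • y + (orient o x y / w) • z := by
    refine Prod.ext ?_ ?_
    · simp only [Prod.fst_add, Prod.smul_fst, smul_eq_mul]
      field_simp
      rw [hw]; unfold orient; ring
    · simp only [Prod.snd_add, Prod.smul_snd, smul_eq_mul]
      field_simp
      rw [hw]; unfold orient; ring
  rw [he]
  have hs := hcv.sum_mem (t := (Finset.univ : Finset (Fin 3)))
    (w := ![orient o y z / w, orient o z x / w, orient o x y / w]) (z := ![x, y, z])
    (by intro i _; fin_cases i <;> simp <;> positivity)
    (by simp [Fin.sum_univ_three]; field_simp; rw [hw]; ring)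
    (by intro i _; fin_cases i <;> simp [*])
  simpa [Fin.sum_univ_three] using hs

/-! ### The order of the points along the convex hull -/

/-- `z` lies strictly between `x` and `y`. -/
def Btw (x y z : ℕ) : Prop := (x < z ∧ z < y) ∨ (y < z ∧ z < x)

/-- `z` lies strictly outside the interval spanned by `x` and `y`. -/
def Out (x y z : ℕ) : Prop := (z < x ∧ z < y) ∨ (x < z ∧ y < z)

/-- The pairs `{x, y}` and `{z, w}` alternate. -/
def Alt (x y z w : ℕ) : Prop := (Btw x y z ∧ Out x y w) ∨ (Btw x y w ∧ Out x y z)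

/-- `f` numbers the points of `C` in counterclockwise order along the convex hull. -/
structure HullOrder (C : Finset Pt) (f : Pt → ℕ) : Prop where
  inj : ∀ a ∈ C, ∀ b ∈ C, f a = f b → a = b
  pos : ∀ a ∈ C, ∀ b ∈ C, ∀ c ∈ C, f a < f b → f b < f c → 0 < orient a b c

/-- A hull order can start at any given point `o`: the other points are sorted by their angle
at `o`. -/
lemma exists_hullOrder_of_mem {C : Finset Pt} (hC : ConvexPosition C) (hG : GeneralPosition C)
    {o : Pt} (ho : o ∈ C) : ∃ f : Pt → ℕ, HullOrder C f ∧ f o = 0 := by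
  classical
  let lt : Pt → Pt → Prop := fun x y => (x = o ∧ y ≠ o) ∨ (x ≠ o ∧ 0 < orient o x y)
  have lt_irr : ∀ x, ¬ lt x x := by
    intro x hx
    rcases hx with ⟨h1, h2⟩ | ⟨h1, h2⟩
    · exact h2 h1
    · rw [orient_self_right] at h2; exact lt_irrefl _ h2
  have lt_o : ∀ x, ¬ lt x o := by
    intro x hx
    rcases hx with ⟨h1, h2⟩ | ⟨h1, h2⟩
    · exact h2 rfl
    · rw [orient_self_left] at h2; exact lt_irrefl _ h2
  have total : ∀ x ∈ C, ∀ y ∈ C, x ≠ y → lt x y ∨ lt y x := by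
    intro x hx y hy hxy
    by_cases h1 : x = o
    · exact Or.inl (Or.inl ⟨h1, fun h => hxy (h1.trans h.symm)⟩)
    by_cases h2 : y = o
    · exact Or.inr (Or.inl ⟨h2, h1⟩)
    rcases (hG.orient_ne_zero ho hx hy (Ne.symm h1) hxy (Ne.symm h2)).lt_or_gt with h | h
    · refine Or.inr (Or.inr ⟨h2, ?_⟩)
      have : orient o y x = - orient o x y := by unfold orient; ring
      linarith
    · exact Or.inl (Or.inr ⟨h1, h⟩)
  have trans : ∀ x ∈ C, ∀ y ∈ C, ∀ z ∈ C, lt x y → lt y z → lt x z := by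
    intro x hx y hy z hz hxy hyz
    have hzo : z ≠ o := by rintro rfl; exact lt_o _ hyz
    have hyo : y ≠ o := by rintro rfl; exact lt_o _ hxy
    rcases hxy with ⟨h1, h2⟩ | ⟨h1, h2⟩
    · exact Or.inl ⟨h1, hzo⟩
    rcases hyz with ⟨h3, -⟩ | ⟨-, h4⟩
    · exact absurd h3 hyo
    refine Or.inr ⟨h1, ?_⟩
    have hni := hC.not_mem_triangle ho hx hy hz h2 h4
    have hxz : x ≠ z := by
      rintro rfl
      have : orient o y x = - orient o x y := by unfold orient; ring
      linarith
    have hne := hG.orient_ne_zero ho hx hz (Ne.symm h1) hxz (Ne.symm hzo)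
    have : orient o z x = - orient o x z := by unfold orient; ring
    rcases hne.lt_or_gt with h | h
    · exact absurd (by linarith) hni
    · exact h
  let f : Pt → ℕ := fun x => (C.filter (fun y => lt y x)).card
  have mono : ∀ x ∈ C, ∀ y ∈ C, lt x y → f x < f y := by
    intro x hx y hy hxy
    apply Finset.card_lt_card
    refine Finset.ssubset_iff_of_subset ?_ |>.2 ⟨x, ?_, ?_⟩
    · intro z hz
      rw [Finset.mem_filter] at hz ⊢
      exact ⟨hz.1, trans z hz.1 x hx y hy hz.2 hxy⟩
    · exact Finset.mem_filter.2 ⟨hx, hxy⟩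
    · exact fun h => lt_irr x (Finset.mem_filter.1 h).2
  have mono' : ∀ x ∈ C, ∀ y ∈ C, f x < f y → lt x y := by
    intro x hx y hy h
    have hne : x ≠ y := by rintro rfl; exact lt_irrefl _ h
    rcases total x hx y hy hne with h' | h'
    · exact h'
    · exact absurd (mono y hy x hx h') (by omega)
  refine ⟨f, ⟨?_, ?_⟩, ?_⟩
  · intro a ha b hb hab
    by_contra hne
    rcases total a ha b hb hne with h | h
    · exact absurd (mono a ha b hb h) (by omega)
    · exact absurd (mono b hb a ha h) (by omega)
  · intro a ha b hb c hc hab hbc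
    have h1 := mono' a ha b hb hab
    have h2 := mono' b hb c hc hbc
    have h3 := trans a ha b hb c hc h1 h2
    have hb0 : b ≠ o := by rintro rfl; exact lt_o _ h1
    have hc0 : c ≠ o := by rintro rfl; exact lt_o _ h2
    have h2' : 0 < orient o b c := by
      rcases h2 with ⟨h, -⟩ | ⟨-, h⟩
      · exact absurd h hb0
      · exact h
    by_cases ha0 : a = o
    · rw [ha0]; exact h2'
    have h1' : 0 < orient o a b := by
      rcases h1 with ⟨h, -⟩ | ⟨-, h⟩
      · exact absurd h ha0
      · exact h
    have h3' : 0 < orient o a c := by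
      rcases h3 with ⟨h, -⟩ | ⟨-, h⟩
      · exact absurd h ha0
      · exact h
    have hab' : a ≠ b := by rintro rfl; omega
    have hbc' : b ≠ c := by rintro rfl; omega
    have hac' : a ≠ c := by rintro rfl; omega
    have hne := hG.orient_ne_zero ha hb hc hab' hbc' hac'
    by_contra hle
    -- otherwise `b` lies in the triangle `o a c`
    refine hC.not_mem_triangle hb ho ha hc ?_ ?_ ?_
    · have : orient b o a = orient o a b := by unfold orient; ring
      linarith
    · have : orient b a c = - orient a b c := by unfold orient; ring
      have := lt_of_le_of_ne (not_lt.1 hle) hne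
      linarith
    · have : orient b c o = orient o b c := by unfold orient; ring
      linarith
  · simp only [f, Finset.card_eq_zero, Finset.filter_eq_empty_iff]
    exact fun x _ => lt_o x

lemma exists_hullOrder {C : Finset Pt} (hC : ConvexPosition C) (hG : GeneralPosition C) :
    ∃ f : Pt → ℕ, HullOrder C f := by
  rcases C.eq_empty_or_nonempty with rfl | ⟨o, ho⟩
  · exact ⟨fun _ => 0, by simp, by simp⟩
  · obtain ⟨f, hf, -⟩ := exists_hullOrder_of_mem hC hG ho
    exact ⟨f, hf⟩

namespace HullOrder

variable {C : Finset Pt} {f : Pt → ℕ}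

lemma ne (hf : HullOrder C f) {a b : Pt} (ha : a ∈ C) (hb : b ∈ C) (h : a ≠ b) : f a ≠ f b :=
  fun h' => h (hf.inj a ha b hb h')

lemma orient_pos_of_out (hf : HullOrder C f) {a b c : Pt} (ha : a ∈ C) (hb : b ∈ C) (hc : c ∈ C)
    (hab : f a < f b) (h : Out (f a) (f b) (f c)) : 0 < orient a b c := by
  rcases h with ⟨h1, h2⟩ | ⟨h1, h2⟩
  · have := hf.pos c hc a ha b hb h1 hab
    rwa [← orient_rotate] at this
  · exact hf.pos a ha b hb c hc hab h2

lemma orient_neg_of_btw (hf : HullOrder C f) {a b c : Pt} (ha : a ∈ C) (hb : b ∈ C) (hc : c ∈ C)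
    (hab : f a < f b) (h : Btw (f a) (f b) (f c)) : orient a b c < 0 := by
  rcases h with ⟨h1, h2⟩ | ⟨h1, h2⟩
  · have := hf.pos a ha c hc b hb h1 h2
    have e : orient a b c = - orient a c b := by unfold orient; ring
    linarith
  · omega

/-- The line through `a` and `b` separates `c` from `d` if and only if the pairs alternate. -/
lemma orient_mul_neg_iff (hf : HullOrder C f) {a b c d : Pt} (ha : a ∈ C) (hb : b ∈ C)
    (hc : c ∈ C) (hd : d ∈ C) :
    orient a b c * orient a b d < 0 ↔ Alt (f a) (f b) (f c) (f d) := by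
  wlog hab : f a < f b generalizing a b
  · rcases (not_lt.1 hab).lt_or_eq with h | h
    · have := this hb ha h
      rw [orient_swap a b, orient_swap a b, neg_mul_neg] at this
      rw [this]
      unfold Alt Btw Out
      omega
    · have h' := hf.inj b hb a ha h
      subst h'
      simp only [orient_self, mul_zero, lt_self_iff_false, false_iff]
      unfold Alt Btw Out
      omega
  have key : ∀ x ∈ C, (orient a b x = 0 ∧ (f x = f a ∨ f x = f b)) ∨
      (0 < orient a b x ∧ Out (f a) (f b) (f x)) ∨ (orient a b x < 0 ∧ Btw (f a) (f b) (f x)) := by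
    intro x hx
    by_cases h1 : f x = f a
    · refine Or.inl ⟨?_, Or.inl h1⟩
      rw [hf.inj x hx a ha h1, orient_self_left]
    by_cases h2 : f x = f b
    · refine Or.inl ⟨?_, Or.inr h2⟩
      rw [hf.inj x hx b hb h2, orient_self_right]
    by_cases h3 : Out (f a) (f b) (f x)
    · exact Or.inr (Or.inl ⟨hf.orient_pos_of_out ha hb hx hab h3, h3⟩)
    · have h4 : Btw (f a) (f b) (f x) := by unfold Out at h3; unfold Btw; omega
      exact Or.inr (Or.inr ⟨hf.orient_neg_of_btw ha hb hx hab h4, h4⟩)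
  rcases key c hc with ⟨h1, h2⟩ | ⟨h1, h2⟩ | ⟨h1, h2⟩ <;>
  rcases key d hd with ⟨h3, h4⟩ | ⟨h3, h4⟩ | ⟨h3, h4⟩
  · simp only [h1, h3, mul_zero, lt_self_iff_false, false_iff]; unfold Alt Btw Out; omega
  · simp only [h1, zero_mul, lt_self_iff_false, false_iff]; unfold Alt Btw Out; omega
  · simp only [h1, zero_mul, lt_self_iff_false, false_iff]; unfold Alt Btw Out; omega
  · simp only [h3, mul_zero, lt_self_iff_false, false_iff]; unfold Alt Btw Out; omega
  · refine iff_of_false (not_lt.2 (mul_pos h1 h3).le) ?_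
    unfold Alt Btw Out at *; omega
  · refine iff_of_true (mul_neg_of_pos_of_neg h1 h3) (Or.inr ⟨h4, h2⟩)
  · simp only [h3, mul_zero, lt_self_iff_false, false_iff]; unfold Alt Btw Out; omega
  · refine iff_of_true (mul_neg_of_neg_of_pos h1 h3) (Or.inl ⟨h2, h4⟩)
  · refine iff_of_false (not_lt.2 (mul_pos_of_neg_of_neg h1 h3).le) ?_
    unfold Alt Btw Out at *; omega

/-- Chords of a convex point set cross if and only if their endpoints alternate. -/
lemma cross_iff (hf : HullOrder C f) (hG : GeneralPosition C) {a b c d : Pt} (ha : a ∈ C)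
    (hb : b ∈ C) (hc : c ∈ C) (hd : d ∈ C) :
    Cross s(a, b) s(c, d) ↔ Alt (f a) (f b) (f c) (f d) := by
  rw [← hf.orient_mul_neg_iff ha hb hc hd]
  refine ⟨fun h => h.orient_mul_neg hG ha hb hc, fun h => cross_of_orient h ?_⟩
  rw [hf.orient_mul_neg_iff ha hb hc hd] at h
  rw [hf.orient_mul_neg_iff hc hd ha hb]
  unfold Alt Btw Out at *
  omega

end HullOrder

/-! ### Hamiltonian cycles as lists of points -/

/-- The segments traversed by the polygonal path with the given vertices. -/
def pathSegs : List Pt → Multiset Seg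
  | [] => 0
  | [_] => 0
  | x :: y :: l => s(x, y) ::ₘ pathSegs (y :: l)

@[simp] lemma pathSegs_nil : pathSegs [] = 0 := rfl

@[simp] lemma pathSegs_singleton (x : Pt) : pathSegs [x] = 0 := rfl

@[simp] lemma pathSegs_cons_cons (x y : Pt) (l : List Pt) :
    pathSegs (x :: y :: l) = s(x, y) ::ₘ pathSegs (y :: l) := rfl

lemma pathSegs_append_cons (X Y : List Pt) (u v : Pt) :
    pathSegs (X ++ u :: v :: Y) = s(u, v) ::ₘ (pathSegs (X ++ [u]) + pathSegs (v :: Y)) := by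
  induction X with
  | nil => simp
  | cons x X ih =>
    cases X with
    | nil => simp [Multiset.cons_swap]
    | cons x' X =>
      simp only [List.cons_append, pathSegs_cons_cons] at ih ⊢
      rw [ih, Multiset.cons_swap]
      simp

lemma pathSegs_append {X Y : List Pt} {u v : Pt} (hX : X.getLast? = some u)
    (hY : Y.head? = some v) :
    pathSegs (X ++ Y) = s(u, v) ::ₘ (pathSegs X + pathSegs Y) := by
  obtain ⟨X', rfl⟩ := List.getLast?_eq_some_iff.1 hX
  obtain ⟨Y', rfl⟩ := List.head?_eq_some_iff.1 hY
  rw [List.append_assoc]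
  exact pathSegs_append_cons X' Y' u v

lemma pathSegs_reverse (l : List Pt) : pathSegs l.reverse = pathSegs l := by
  induction l with
  | nil => rfl
  | cons x l ih =>
    cases l with
    | nil => rfl
    | cons y l =>
      rw [List.reverse_cons, pathSegs_append (u := y) (v := x) (by simp) (by simp), ih,
        Sym2.eq_swap]
      simp

lemma exists_infix_of_mem_pathSegs {l : List Pt} {s : Seg} (h : s ∈ pathSegs l) :
    ∃ X Y u v, l = X ++ u :: v :: Y ∧ s = s(u, v) := by
  induction l with
  | nil => simp at h
  | cons x l ih =>
    cases l with
    | nil => simp at h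
    | cons y l =>
      rw [pathSegs_cons_cons, Multiset.mem_cons] at h
      rcases h with h | h
      · exact ⟨[], l, x, y, rfl, h⟩
      · obtain ⟨X, Y, u, v, h1, h2⟩ := ih h
        exact ⟨x :: X, Y, u, v, by rw [h1]; rfl, h2⟩

lemma infix_or_infix_of_mem_pathSegs {l : List Pt} {b d : Pt} (h : s(b, d) ∈ pathSegs l) :
    [b, d] <:+: l ∨ [d, b] <:+: l := by
  obtain ⟨X, Y, u, v, h1, h2⟩ := exists_infix_of_mem_pathSegs h
  rcases Sym2.eq_iff.1 h2 with ⟨rfl, rfl⟩ | ⟨rfl, rfl⟩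
  · exact Or.inl ⟨X, Y, by simp [h1]⟩
  · exact Or.inr ⟨X, Y, by simp [h1]⟩

lemma mem_of_mem_pathSegs {l : List Pt} {s : Seg} (h : s ∈ pathSegs l) {p : Pt} (hp : p ∈ s) :
    p ∈ l := by
  obtain ⟨X, Y, u, v, rfl, rfl⟩ := exists_infix_of_mem_pathSegs h
  rcases Sym2.mem_iff.1 hp with rfl | rfl <;> simp

/-- A set of points that no segment of a path leaves contains all or none of its vertices. -/
lemma mem_iff_of_pathSegs {l : List Pt} {Z : Set Pt}
    (h : ∀ x y, s(x, y) ∈ pathSegs l → (x ∈ Z ↔ y ∈ Z)) {x y : Pt} (hx : x ∈ l) (hy : y ∈ l) :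
    x ∈ Z ↔ y ∈ Z := by
  induction l generalizing x y with
  | nil => simp at hx
  | cons z l ih =>
    cases l with
    | nil => simp at hx hy; rw [hx, hy]
    | cons w l =>
      have ih' := fun {x y} => @ih (fun x y hxy => h x y (by simp [hxy])) x y
      have hzw := h z w (by simp)
      have key : ∀ t ∈ z :: w :: l, (t ∈ Z ↔ w ∈ Z) := by
        intro t ht
        rcases List.mem_cons.1 ht with rfl | ht
        · exact hzw
        · exact ih' ht (by simp)
      rw [key x hx, key y hy]

/-- The list `l` enumerates `P`, and `S` is the Hamiltonian cycle formed by the path along `l`,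
which runs from `c` to `a`, and the closing segment `a c`. -/
structure IsTour (P : Finset Pt) (a c : Pt) (l : List Pt) (S : Multiset Seg) : Prop where
  nodup : l.Nodup
  length : 3 ≤ l.length
  mem : ∀ p, p ∈ l ↔ p ∈ P
  head : l.head? = some c
  last : l.getLast? = some a
  eq : S = s(a, c) ::ₘ pathSegs l

lemma zipWith_eq_pathSegs (x z : Pt) (l : List Pt) :
    ((List.zipWith (fun a b => s(a, b)) (x :: l) (l ++ [z]) : List Seg) : Multiset Seg) =
      pathSegs (x :: l ++ [z]) := by
  induction l generalizing x with
  | nil => rfl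
  | cons y l ih =>
    have := ih y
    simp only [List.cons_append, List.zipWith_cons_cons, pathSegs_cons_cons] at this ⊢
    rw [← this]
    rfl

lemma zipWith_rotate_eq {l : List Pt} {a c : Pt} (hc : l.head? = some c)
    (ha : l.getLast? = some a) :
    ((List.zipWith (fun a b => s(a, b)) l (l.rotate 1) : List Seg) : Multiset Seg) =
      s(a, c) ::ₘ pathSegs l := by
  obtain ⟨l', rfl⟩ := List.head?_eq_some_iff.1 hc
  rw [List.rotate_cons_succ, List.rotate_zero, zipWith_eq_pathSegs,
    pathSegs_append ha (v := c) (by simp)]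
  simp

lemma IsTour.isHamCycle {P : Finset Pt} {a c : Pt} {l : List Pt} {S : Multiset Seg}
    (h : IsTour P a c l S) : IsHamCycle P S :=
  ⟨l, h.nodup, h.length, h.mem, by rw [zipWith_rotate_eq h.head h.last, h.eq]⟩

lemma IsTour.reverse {P : Finset Pt} {a c : Pt} {l : List Pt} {S : Multiset Seg}
    (h : IsTour P a c l S) : IsTour P c a l.reverse S where
  nodup := List.nodup_reverse.2 h.nodup
  length := by rw [List.length_reverse]; exact h.length
  mem p := by rw [List.mem_reverse]; exact h.mem p
  head := by rw [List.head?_reverse]; exact h.last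
  last := by rw [List.getLast?_reverse]; exact h.head
  eq := by rw [pathSegs_reverse, h.eq, Sym2.eq_swap]

/-- Every segment of a Hamiltonian cycle can serve as the closing segment, in both directions. -/
lemma IsHamCycle.exists_isTour {P : Finset Pt} {S : Multiset Seg} (h : IsHamCycle P S) {a c : Pt}
    (hs : s(a, c) ∈ S) : ∃ l, IsTour P a c l S := by
  suffices H : ∃ u v l, s(a, c) = s(u, v) ∧ IsTour P u v l S by
    obtain ⟨u, v, l, h1, h2⟩ := H
    rcases Sym2.eq_iff.1 h1 with ⟨rfl, rfl⟩ | ⟨rfl, rfl⟩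
    · exact ⟨l, h2⟩
    · exact ⟨l.reverse, h2.reverse⟩
  obtain ⟨l, h1, h2, h3, rfl⟩ := h
  obtain ⟨x, l', rfl⟩ : ∃ x l', l = x :: l' := by
    cases l with
    | nil => simp at h2
    | cons x l' => exact ⟨x, l', rfl⟩
  obtain ⟨z, hz⟩ : ∃ z, (x :: l').getLast? = some z := by
    rw [← Option.isSome_iff_exists]; simp
  have e := zipWith_rotate_eq (l := x :: l') (c := x) (a := z) (by simp) hz
  have hs' := hs
  rw [e, Multiset.mem_cons] at hs'
  rcases hs' with hs' | hs'
  · exact ⟨z, x, x :: l', hs', ⟨h1, h2, h3, by simp, hz, e⟩⟩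
  · obtain ⟨X, Y, u, v, h4, h5⟩ := exists_infix_of_mem_pathSegs hs'
    have h4' : x :: l' = (X ++ [u]) ++ (v :: Y) := by rw [h4]; simp
    have hrot : (x :: l').rotate (X ++ [u]).length = (v :: Y) ++ (X ++ [u]) := by
      rw [h4', List.rotate_append_length_eq]
    have hperm := List.rotate_perm (x :: l') (X ++ [u]).length
    rw [hrot] at hperm
    refine ⟨u, v, (v :: Y) ++ (X ++ [u]), h5, ⟨hperm.nodup_iff.2 h1, ?_, ?_, by simp, ?_, ?_⟩⟩
    · rw [hperm.length_eq]; exact h2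
    · intro p; rw [hperm.mem_iff]; exact h3 p
    · rw [← List.append_assoc]; exact List.getLast?_concat
    · rw [← zipWith_rotate_eq (l := (v :: Y) ++ (X ++ [u])) (c := v) (a := u) (by simp)
        (by rw [← List.append_assoc]; exact List.getLast?_concat), ← hrot, List.rotate_rotate,
        add_comm, ← List.rotate_rotate, ← List.zipWith_rotate_distrib _ _ _ _ (by simp)]
      exact (Multiset.coe_eq_coe.2 (List.rotate_perm _ _)).symm

/-- Reversing the second part of a tour replaces the segments `a c`, `u v` by `v c`, `u a`. -/
lemma IsTour.two_opt {P : Finset Pt} {a c u v : Pt} {X Y : List Pt} {S : Multiset Seg}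
    (h : IsTour P a c (X ++ Y) S) (hX : X.getLast? = some u) (hY : Y.head? = some v) :
    IsTour P v c (X ++ Y.reverse) (s(v, c) ::ₘ s(u, a) ::ₘ (pathSegs X + pathSegs Y)) := by
  have hXne : X ≠ [] := by rintro rfl; simp at hX
  have hYne : Y ≠ [] := by rintro rfl; simp at hY
  have hperm : (X ++ Y.reverse).Perm (X ++ Y) := (List.reverse_perm Y).append_left X
  refine ⟨hperm.nodup_iff.2 h.nodup, by rw [hperm.length_eq]; exact h.length,
    fun p => by rw [hperm.mem_iff]; exact h.mem p, ?_, ?_, ?_⟩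
  · rw [← h.head, List.head?_append_of_ne_nil _ hXne, List.head?_append_of_ne_nil _ hXne]
  · rw [List.getLast?_append_of_ne_nil _ (by simpa using hYne), List.getLast?_reverse, hY]
  · have : Y.reverse.head? = some a := by
      rw [List.head?_reverse, ← h.last, List.getLast?_append_of_ne_nil _ hYne]
    rw [pathSegs_append hX this, pathSegs_reverse]

/-- A set of points that no segment of a Hamiltonian cycle leaves contains all or none of the
vertices. -/
lemma IsHamCycle.mem_iff {P : Finset Pt} {S : Multiset Seg} (h : IsHamCycle P S) {Z : Set Pt}
    (hZ : ∀ x y, s(x, y) ∈ S → (x ∈ Z ↔ y ∈ Z)) {x y : Pt} (hx : x ∈ P) (hy : y ∈ P) :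
    x ∈ Z ↔ y ∈ Z := by
  obtain ⟨l, h1, h2, h3, rfl⟩ := h
  obtain ⟨c, hc⟩ : ∃ c, l.head? = some c := by
    cases l with
    | nil => simp at h2
    | cons x l' => exact ⟨x, rfl⟩
  obtain ⟨a, ha⟩ : ∃ a, l.getLast? = some a := by
    have : l ≠ [] := by rintro rfl; simp at h2
    exact ⟨_, List.getLast?_eq_some_getLast this⟩
  rw [zipWith_rotate_eq hc ha] at hZ
  exact mem_iff_of_pathSegs (fun x y h => hZ x y (by simp [h])) ((h3 x).2 hx) ((h3 y).2 hy)

/-- The other reconnection of the segments `a c`, `u v` splits a tour into two closed curves. -/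
lemma IsTour.not_isHamCycle {P : Finset Pt} {a c u v : Pt} {X Y : List Pt} {S : Multiset Seg}
    (h : IsTour P a c (X ++ Y) S) (hX : X.getLast? = some u) (hY : Y.head? = some v) :
    ¬ IsHamCycle P (s(v, a) ::ₘ s(u, c) ::ₘ (pathSegs X + pathSegs Y)) := by
  intro hH
  have hXne : X ≠ [] := by rintro rfl; simp at hX
  have hYne : Y ≠ [] := by rintro rfl; simp at hY
  have hu : u ∈ X := List.mem_of_getLast? hX
  have hv : v ∈ Y := List.mem_of_head? hY
  have hc : c ∈ X := by
    have := h.head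
    rw [List.head?_append_of_ne_nil _ hXne] at this
    exact List.mem_of_head? this
  have ha : a ∈ Y := by
    have := h.last
    rw [List.getLast?_append_of_ne_nil _ hYne] at this
    exact List.mem_of_getLast? this
  have hdis : ∀ p ∈ Y, p ∉ X := fun p hp hp' =>
    (List.nodup_append.1 h.nodup).2.2 p hp' p hp rfl
  have := hH.mem_iff (Z := {p | p ∈ X}) (x := u) (y := v) ?_
    ((h.mem u).1 (List.mem_append_left _ hu)) ((h.mem v).1 (List.mem_append_right _ hv))
  · exact hdis v hv (this.1 hu)
  · intro x y hxy
    simp only [Multiset.mem_cons, Multiset.mem_add, Set.mem_ofPred_eq] at hxy ⊢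
    rcases hxy with hxy | hxy | hxy | hxy
    · have := hdis v hv
      have := hdis a ha
      rcases Sym2.eq_iff.1 hxy with ⟨rfl, rfl⟩ | ⟨rfl, rfl⟩ <;> tauto
    · rcases Sym2.eq_iff.1 hxy with ⟨rfl, rfl⟩ | ⟨rfl, rfl⟩ <;> tauto
    · exact iff_of_true (mem_of_mem_pathSegs hxy (by simp)) (mem_of_mem_pathSegs hxy (by simp))
    · exact iff_of_false (hdis x (mem_of_mem_pathSegs hxy (by simp)))
        (hdis y (mem_of_mem_pathSegs hxy (by simp)))

lemma IsHamCycle.flip {P : Finset Pt} {a b c d : Pt} {U : Multiset Seg}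
    (h : IsHamCycle P (s(a, b) ::ₘ s(c, d) ::ₘ U)) :
    IsHamCycle P (s(a, c) ::ₘ s(b, d) ::ₘ U) ∨ IsHamCycle P (s(a, d) ::ₘ s(b, c) ::ₘ U) := by
  obtain ⟨l, hl⟩ := h.exists_isTour (a := a) (c := b) (by simp)
  have he : s(c, d) ::ₘ U = pathSegs l := Multiset.cons_inj_right _ |>.1 hl.eq
  have hm : s(c, d) ∈ pathSegs l := by rw [← he]; simp
  rcases infix_or_infix_of_mem_pathSegs hm with ⟨X, Y, h1⟩ | ⟨X, Y, h1⟩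
  · have h1' : l = (X ++ [c]) ++ (d :: Y) := by rw [← h1]; simp
    subst h1'
    rw [pathSegs_append (u := c) (v := d) (by simp) (by simp), Multiset.cons_inj_right] at he
    have := (hl.two_opt (u := c) (v := d) (by simp) (by simp)).isHamCycle
    rw [← he, Multiset.cons_swap, Sym2.eq_swap, Sym2.eq_swap (a := d)] at this
    exact Or.inl this
  · have h1' : l = (X ++ [d]) ++ (c :: Y) := by rw [← h1]; simp
    subst h1'
    rw [pathSegs_append (u := d) (v := c) (by simp) (by simp), Sym2.eq_swap,
      Multiset.cons_inj_right] at he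
    have := (hl.two_opt (u := d) (v := c) (by simp) (by simp)).isHamCycle
    rw [← he, Multiset.cons_swap, Sym2.eq_swap, Sym2.eq_swap (a := c)] at this
    exact Or.inr this

lemma two_le_degree_of_isHamCycle {P : Finset Pt} {S : Multiset Seg} (h : IsHamCycle P S) {q : Pt}
    (hq : q ∈ P) : 2 ≤ degree q S := by
  classical
  obtain ⟨y, hy⟩ : ∃ y, s(q, y) ∈ S := by
    by_contra! hcon
    have h3 : ∃ p ∈ P, p ≠ q := by
      obtain ⟨l, h1, h2, h3, -⟩ := h
      match l, h1, h2, h3 with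
      | x :: y :: l, h1, h2, h3 =>
        by_cases hx : x = q
        · refine ⟨y, (h3 y).1 (by simp), ?_⟩
          rintro rfl
          simp [hx] at h1
        · exact ⟨x, (h3 x).1 (by simp), hx⟩
    obtain ⟨p, hp, hpq⟩ := h3
    refine hpq ((h.mem_iff (Z := {q}) ?_ hp hq).2 rfl)
    intro x y hxy
    simp only [Set.mem_singleton_iff]
    refine iff_of_false ?_ ?_
    · rintro rfl; exact hcon _ hxy
    · rintro rfl; rw [Sym2.eq_swap] at hxy; exact hcon _ hxy
  obtain ⟨l, hl⟩ := h.exists_isTour hy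
  obtain ⟨M, hM⟩ := List.getLast?_eq_some_iff.1 hl.last
  have hlen := hl.length
  obtain ⟨z, hz⟩ : ∃ z, M.getLast? = some z := by
    have : M ≠ [] := by rintro rfl; simp [hM] at hlen
    exact ⟨_, List.getLast?_eq_some_getLast this⟩
  rw [hl.eq, hM, pathSegs_append hz (v := q) (by simp), degree,
    Multiset.filter_cons_of_pos _ (by simp), Multiset.filter_cons_of_pos _ (by simp)]
  simp

/-! ### Existence of flips -/

/-- The segments of `S` are proper segments with endpoints in `P`. -/
def SegsIn (P : Finset Pt) (S : Multiset Seg) : Prop := ∀ s ∈ S, ¬ s.IsDiag ∧ ∀ p ∈ s, p ∈ P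

/-- Two points are linked if they are joined by a chain of segments of `S`. -/
def Linked (S : Multiset Seg) : Pt → Pt → Prop := Relation.ReflTransGen (fun u v => s(u, v) ∈ S)

lemma Linked.symm {S : Multiset Seg} {x y : Pt} (h : Linked S x y) : Linked S y x := by
  have : Std.Symm (fun u v => s(u, v) ∈ S) := ⟨fun u v h => by rwa [Sym2.eq_swap]⟩
  exact Std.Symm.symm (r := Relation.ReflTransGen (fun u v => s(u, v) ∈ S)) x y h

lemma Linked.trans {S : Multiset Seg} {x y z : Pt} (h : Linked S x y) (h' : Linked S y z) :
    Linked S x z :=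
  Relation.ReflTransGen.trans h h'

lemma Linked.single {S : Multiset Seg} {x y : Pt} (h : s(x, y) ∈ S) : Linked S x y :=
  Relation.ReflTransGen.single h

lemma Linked.mono {S T : Multiset Seg} (hST : ∀ s ∈ S, s ∈ T) {x y : Pt} (h : Linked S x y) :
    Linked T x y :=
  Relation.ReflTransGen.mono (fun _ _ h => hST _ h) _ _ h

/-- A set of points that no segment leaves is closed under being linked. -/
lemma Linked.mem_of_closed {S : Multiset Seg} {x y : Pt} (h : Linked S x y) {Z : Set Pt}
    (hZ : ∀ u v, s(u, v) ∈ S → u ∈ Z → v ∈ Z) (hx : x ∈ Z) : y ∈ Z := by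
  induction h with
  | refl => exact hx
  | tail _ h ih => exact hZ _ _ h ih

lemma graphOn_connected_iff {P : Finset Pt} {S : Multiset Seg} (hS : SegsIn P S) :
    (graphOn P S).Connected ↔ P.Nonempty ∧ ∀ x ∈ P, ∀ y ∈ P, Linked S x y := by
  rw [SimpleGraph.connected_iff]
  constructor
  · rintro ⟨h1, ⟨⟨o, ho⟩⟩⟩
    refine ⟨⟨o, ho⟩, fun x hx y hy => ?_⟩
    have := (SimpleGraph.reachable_iff_reflTransGen _ _).1 (h1 ⟨x, hx⟩ ⟨y, hy⟩)
    exact Relation.ReflTransGen.lift (r := (graphOn P S).Adj) (fun p : {p // p ∈ P} => (p : Pt))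
      (fun a b h => h.2) _ _ this
  · rintro ⟨⟨o, ho⟩, h⟩
    refine ⟨?_, ⟨⟨o, ho⟩⟩⟩
    rintro ⟨x, hx⟩ ⟨y, hy⟩
    have key : ∀ z, Linked S x z → ∀ hz : z ∈ P, (graphOn P S).Reachable ⟨x, hx⟩ ⟨z, hz⟩ := by
      intro z hxz
      induction hxz with
      | refl => exact fun _ => SimpleGraph.Reachable.refl _
      | @tail u v _ huv ih =>
        intro hz
        have hu := (hS _ huv).2 u (by simp)
        refine (ih hu).trans (SimpleGraph.Adj.reachable ⟨?_, huv⟩)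
        intro he
        have : u = v := congrArg Subtype.val he
        exact (hS _ huv).1 (by simp [this])
    exact key y (h x hx y hy) hy

lemma card_edgeSet_graphOn {P : Finset Pt} {S : Multiset Seg} (hS : SegsIn P S) [DecidableEq Seg] :
    Nat.card (graphOn P S).edgeSet = S.toFinset.card := by
  have hinj : Function.Injective (Sym2.map (Subtype.val : {p // p ∈ P} → Pt)) :=
    Sym2.map.injective Subtype.val_injective
  rw [Nat.card_coe_set_eq, ← Set.ncard_image_of_injective _ hinj, ← Set.ncard_coe_finset]
  congr 1
  ext s
  simp only [Set.mem_image, Finset.mem_coe, Multiset.mem_toFinset]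
  constructor
  · rintro ⟨e, he, rfl⟩
    induction e using Sym2.ind with
    | _ a b => exact he.2
  · intro hs
    have h := hS s hs
    induction s using Sym2.ind with
    | _ a b =>
      refine ⟨s(⟨a, h.2 a (by simp)⟩, ⟨b, h.2 b (by simp)⟩), ⟨?_, hs⟩, rfl⟩
      intro he
      have : a = b := congrArg Subtype.val he
      exact h.1 (by simp [this])

/-- Spanning trees are the connected multigraphs with one segment less than points. -/
lemma isSpanningTree_iff {P : Finset Pt} {S : Multiset Seg} (hS : SegsIn P S) :
    IsSpanningTree P S ↔ (P.Nonempty ∧ ∀ x ∈ P, ∀ y ∈ P, Linked S x y) ∧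
      Multiset.card S + 1 = P.card := by
  classical
  unfold IsSpanningTree
  rw [← graphOn_connected_iff hS, SimpleGraph.isTree_iff_connected_and_card,
    card_edgeSet_graphOn hS, Nat.card_eq_fintype_card, Fintype.card_coe]
  constructor
  · rintro ⟨h1, h2, h3⟩
    rw [Multiset.toFinset_card_of_nodup h1] at h3
    exact ⟨h2, h3⟩
  · rintro ⟨h1, h2⟩
    have h3 := h1.card_vert_le_card_edgeSet_add_one
    rw [card_edgeSet_graphOn hS, Nat.card_eq_fintype_card, Fintype.card_coe] at h3
    have h4 := Multiset.toFinset_card_le S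
    have h5 : S.toFinset.card = Multiset.card S := by omega
    exact ⟨Multiset.toFinset_card_eq_card_iff_nodup.1 h5, h1, by omega⟩

/-- One of the two reconnections of two segments preserves connectedness: the one that joins the
parts of the graph left by the removal. -/
lemma linked_flip {P : Finset Pt} {a b c d : Pt} {U : Multiset Seg} (ha : a ∈ P) (hc : c ∈ P)
    (h : ∀ x ∈ P, ∀ y ∈ P, Linked (s(a, b) ::ₘ s(c, d) ::ₘ U) x y) :
    (∀ x ∈ P, ∀ y ∈ P, Linked (s(a, c) ::ₘ s(b, d) ::ₘ U) x y) ∨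
      (∀ x ∈ P, ∀ y ∈ P, Linked (s(a, d) ::ₘ s(b, c) ::ₘ U) x y) := by
  have h1 : Linked U a c ∨ Linked U a d ∨ Linked U b c ∨ Linked U b d := by
    by_contra! hcon
    obtain ⟨n1, n2, n3, n4⟩ := hcon
    have := (h a ha c hc).mem_of_closed (Z := {v | Linked U a v ∨ Linked U b v}) ?_
      (Or.inl Relation.ReflTransGen.refl)
    · rcases this with h | h
      exacts [n1 h, n3 h]
    · intro u v huv hu
      simp only [Multiset.mem_cons] at huv
      rcases huv with huv | huv | huv
      · rcases Sym2.eq_iff.1 huv with ⟨rfl, rfl⟩ | ⟨rfl, rfl⟩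
        · exact Or.inr Relation.ReflTransGen.refl
        · exact Or.inl Relation.ReflTransGen.refl
      · rcases Sym2.eq_iff.1 huv with ⟨rfl, rfl⟩ | ⟨rfl, rfl⟩
        · rcases hu with h | h
          exacts [absurd h n1, absurd h n3]
        · rcases hu with h | h
          exacts [absurd h n2, absurd h n4]
      · rcases hu with h | h
        · exact Or.inl (h.trans (Linked.single huv))
        · exact Or.inr (h.trans (Linked.single huv))
  have h2 : ∀ x ∈ P, Linked U a x ∨ Linked U b x ∨ Linked U c x ∨ Linked U d x := by
    intro x hx
    refine (h a ha x hx).mem_of_closed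
      (Z := {x | Linked U a x ∨ Linked U b x ∨ Linked U c x ∨ Linked U d x}) ?_
      (Or.inl Relation.ReflTransGen.refl)
    intro u v huv hu
    have rfl' : ∀ w, Linked U w w := fun _ => Relation.ReflTransGen.refl
    simp only [Multiset.mem_cons] at huv
    rcases huv with huv | huv | huv
    · rcases Sym2.eq_iff.1 huv with ⟨rfl, rfl⟩ | ⟨rfl, rfl⟩
      · exact Or.inr (Or.inl (rfl' _))
      · exact Or.inl (rfl' _)
    · rcases Sym2.eq_iff.1 huv with ⟨rfl, rfl⟩ | ⟨rfl, rfl⟩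
      · exact Or.inr (Or.inr (Or.inr (rfl' _)))
      · exact Or.inr (Or.inr (Or.inl (rfl' _)))
    · have e := Linked.single huv
      rcases hu with h | h | h | h
      · exact Or.inl (h.trans e)
      · exact Or.inr (Or.inl (h.trans e))
      · exact Or.inr (Or.inr (Or.inl (h.trans e)))
      · exact Or.inr (Or.inr (Or.inr (h.trans e)))
  have h3 : ∀ T : Multiset Seg, (∀ s ∈ U, s ∈ T) → Linked T a b → Linked T a c → Linked T a d →
      ∀ x ∈ P, ∀ y ∈ P, Linked T x y := by
    intro T hU hb hc hd
    have key : ∀ x ∈ P, Linked T a x := by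
      intro x hx
      rcases h2 x hx with h | h | h | h
      · exact h.mono hU
      · exact hb.trans (h.mono hU)
      · exact hc.trans (h.mono hU)
      · exact hd.trans (h.mono hU)
    exact fun x hx y hy => (key x hx).symm.trans (key y hy)
  have hU : ∀ s t : Seg, ∀ r ∈ U, r ∈ s ::ₘ t ::ₘ U := by
    intro s t r hr; simp [hr]
  have ac : Linked (s(a, c) ::ₘ s(b, d) ::ₘ U) a c := Linked.single (by simp)
  have bd : Linked (s(a, c) ::ₘ s(b, d) ::ₘ U) b d := Linked.single (by simp)
  have ad : Linked (s(a, d) ::ₘ s(b, c) ::ₘ U) a d := Linked.single (by simp)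
  have bc : Linked (s(a, d) ::ₘ s(b, c) ::ₘ U) b c := Linked.single (by simp)
  rcases h1 with h | h | h | h
  · have h := h.mono (hU s(a, d) s(b, c))
    exact Or.inr (h3 _ (hU _ _) (h.trans bc.symm) h ad)
  · have h := h.mono (hU s(a, c) s(b, d))
    exact Or.inl (h3 _ (hU _ _) (h.trans bd.symm) ac h)
  · have h := h.mono (hU s(a, c) s(b, d))
    exact Or.inl (h3 _ (hU _ _) (ac.trans h.symm) ac ((ac.trans h.symm).trans bd))
  · have h := h.mono (hU s(a, d) s(b, c))
    exact Or.inr (h3 _ (hU _ _) (ad.trans h.symm) ((ad.trans h.symm).trans bc) ad)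

open Classical in
lemma degree_cons (p : Pt) (s : Seg) (U : Multiset Seg) :
    degree p (s ::ₘ U) = (if p ∈ s then 1 else 0) + degree p U := by
  unfold degree
  rw [Multiset.filter_cons, Multiset.card_add]
  congr 1
  split_ifs <;> simp

lemma degree_add (p : Pt) (A B : Multiset Seg) : degree p (A + B) = degree p A + degree p B := by
  classical
  unfold degree
  rw [Multiset.filter_add, Multiset.card_add]

lemma degree_flip (p : Pt) {a b c d : Pt} (U : Multiset Seg) (hab : a ≠ b) (hcd : c ≠ d)
    (hac : a ≠ c) (hbd : b ≠ d) :
    degree p (s(a, c) ::ₘ s(b, d) ::ₘ U) = degree p (s(a, b) ::ₘ s(c, d) ::ₘ U) := by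
  classical
  simp only [degree_cons, Sym2.mem_iff]
  by_cases h1 : p = a <;> by_cases h2 : p = b <;> by_cases h3 : p = c <;> by_cases h4 : p = d <;>
    simp_all

lemma bichromatic_iff (col : Pt → Bool) (a b : Pt) :
    (∃ u v : Pt, s(a, b) = s(u, v) ∧ col u = true ∧ col v = false) ↔ col a ≠ col b := by
  constructor
  · rintro ⟨u, v, h, h1, h2⟩
    rcases Sym2.eq_iff.1 h with ⟨rfl, rfl⟩ | ⟨rfl, rfl⟩ <;> simp [h1, h2]
  · intro h
    cases ha : col a <;> cases hb : col b
    · simp [ha, hb] at h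
    · exact ⟨b, a, Sym2.eq_swap, hb, ha⟩
    · exact ⟨a, b, rfl, ha, hb⟩
    · simp [ha, hb] at h

lemma segsIn_flip {P : Finset Pt} {a b c d : Pt} {U : Multiset Seg} (hac : a ≠ c) (hbd : b ≠ d)
    (h : SegsIn P (s(a, b) ::ₘ s(c, d) ::ₘ U)) : SegsIn P (s(a, c) ::ₘ s(b, d) ::ₘ U) := by
  have h1 := (h s(a, b) (by simp)).2
  have h2 := (h s(c, d) (by simp)).2
  simp only [Sym2.mem_iff] at h1 h2
  intro s hs
  simp only [Multiset.mem_cons] at hs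
  rcases hs with rfl | rfl | hs
  · refine ⟨by simpa using hac, ?_⟩
    simp only [Sym2.mem_iff]
    rintro p (rfl | rfl)
    exacts [h1 _ (by simp), h2 _ (by simp)]
  · refine ⟨by simpa using hbd, ?_⟩
    simp only [Sym2.mem_iff]
    rintro p (rfl | rfl)
    exacts [h1 _ (by simp), h2 _ (by simp)]
  · exact h s (by simp [hs])

/-- At least one of the two reconnections of a crossing pair preserves the property. -/
lemma IsState.flip {Γ : GraphProperty} {P : Finset Pt} {col : Pt → Bool} {n : ℕ} {a b c d : Pt}
    {U : Multiset Seg} (hab : a ≠ b) (hcd : c ≠ d) (hac : a ≠ c) (had : a ≠ d) (hbc : b ≠ c)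
    (hbd : b ≠ d) (h : IsState Γ P col n (s(a, b) ::ₘ s(c, d) ::ₘ U)) :
    IsState Γ P col n (s(a, c) ::ₘ s(b, d) ::ₘ U) ∨
      IsState Γ P col n (s(a, d) ::ₘ s(b, c) ::ₘ U) := by
  obtain ⟨hn, hP, hS⟩ := h
  have hP' : SegsIn P (s(a, b) ::ₘ s(c, d) ::ₘ U) := hP
  have hP1 : SegsIn P (s(a, c) ::ₘ s(b, d) ::ₘ U) := segsIn_flip hac hbd hP
  have hP2 : SegsIn P (s(a, d) ::ₘ s(b, c) ::ₘ U) := by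
    refine segsIn_flip had hbc ?_
    rw [Sym2.eq_swap (a := d)]; exact hP
  have hn1 : Multiset.card (s(a, c) ::ₘ s(b, d) ::ₘ U) = n := by simpa using hn
  have hn2 : Multiset.card (s(a, d) ::ₘ s(b, c) ::ₘ U) = n := by simpa using hn
  have hd1 : ∀ p, degree p (s(a, c) ::ₘ s(b, d) ::ₘ U) = degree p (s(a, b) ::ₘ s(c, d) ::ₘ U) :=
    fun p => degree_flip p U hab hcd hac hbd
  have hd2 : ∀ p, degree p (s(a, d) ::ₘ s(b, c) ::ₘ U) = degree p (s(a, b) ::ₘ s(c, d) ::ₘ U) := by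
    intro p
    rw [degree_flip p U hab hcd.symm had hbc, Sym2.eq_swap (a := d)]
  cases Γ with
  | multigraph => exact Or.inl ⟨hn1, hP1, trivial⟩
  | cycle =>
    rcases IsHamCycle.flip hS with h | h
    · exact Or.inl ⟨hn1, hP1, h⟩
    · exact Or.inr ⟨hn2, hP2, h⟩
  | tree =>
    obtain ⟨⟨hne, hl⟩, hcard⟩ := (isSpanningTree_iff hP').1 hS
    rcases linked_flip (hP' s(a, b) (by simp) |>.2 a (by simp))
      (hP' s(c, d) (by simp) |>.2 c (by simp)) hl with h | h
    · refine Or.inl ⟨hn1, hP1, (isSpanningTree_iff hP1).2 ⟨⟨hne, h⟩, by rw [hn1, ← hn, hcard]⟩⟩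
    · refine Or.inr ⟨hn2, hP2, (isSpanningTree_iff hP2).2 ⟨⟨hne, h⟩, by rw [hn2, ← hn, hcard]⟩⟩
  | matching => exact Or.inl ⟨hn1, hP1, fun p hp => by rw [hd1]; exact hS p hp⟩
  | redBlue =>
    obtain ⟨hm, hc⟩ := hS
    have c1 := (bichromatic_iff col a b).1 (hc _ (by simp))
    have c2 := (bichromatic_iff col c d).1 (hc _ (by simp))
    by_cases h : col a = col c
    · refine Or.inr ⟨hn2, hP2, fun p hp => by rw [hd2]; exact hm p hp, ?_⟩
      intro s hs
      simp only [Multiset.mem_cons] at hs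
      rcases hs with rfl | rfl | hs
      · exact (bichromatic_iff col a d).2 (by rw [h]; exact c2)
      · exact (bichromatic_iff col b c).2 (by rw [← h]; exact c1.symm)
      · exact hc s (by simp [hs])
    · refine Or.inl ⟨hn1, hP1, fun p hp => by rw [hd1]; exact hm p hp, ?_⟩
      intro s hs
      simp only [Multiset.mem_cons] at hs
      rcases hs with rfl | rfl | hs
      · exact (bichromatic_iff col a c).2 h
      · refine (bichromatic_iff col b d).2 ?_
        revert c1 c2 h
        cases col a <;> cases col b <;> cases col c <;> cases col d <;> simp
      · exact hc s (by simp [hs])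

/-- The possible results of a flip. -/
lemma FlipAt.cases {V : Multiset Seg → Prop} {a b c d : Pt} {S S' : Multiset Seg}
    (h : FlipAt V (s(a, b), s(c, d)) S S') :
    V S ∧ V S' ∧ Cross s(a, b) s(c, d) ∧ ∃ U, S = s(a, b) ::ₘ s(c, d) ::ₘ U ∧
      (S' = s(a, c) ::ₘ s(b, d) ::ₘ U ∨ S' = s(a, d) ::ₘ s(b, c) ::ₘ U) := by
  obtain ⟨h1, h2, h3, a', b', c', d', U, e1, e2, -, e3, e4⟩ := h
  simp only at e1 e2 h3
  refine ⟨h1, h2, h3, U, by rw [e1, e2]; exact e3, ?_⟩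
  rcases Sym2.eq_iff.1 e1 with ⟨rfl, rfl⟩ | ⟨rfl, rfl⟩ <;>
  rcases Sym2.eq_iff.1 e2 with ⟨rfl, rfl⟩ | ⟨rfl, rfl⟩
  · exact Or.inl e4
  · exact Or.inr e4
  · right; rw [e4, Multiset.cons_swap]
  · left; rw [e4, Multiset.cons_swap]

/-- Every crossing pair of an admissible multiset can be flipped, also if some of the other segments
are not allowed to be flipped. -/
lemma exists_flipAt_of_isCrossing {Γ : GraphProperty} {P Q : Finset Pt} (hP : GeneralPosition P)
    {col : Pt → Bool} {n : ℕ} {A B : Multiset Seg} {e : Seg × Seg}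
    (hA : IsState Γ P col n (A + B)) (hQ : ∀ s ∈ A, ∀ p ∈ s, p ∈ Q) (he : IsCrossing A e) :
    ∃ A', FlipAt (fun A => IsState Γ P col n (A + B) ∧ ∀ s ∈ A, ∀ p ∈ s, p ∈ Q) e A A' := by
  obtain ⟨e1, e2⟩ := e
  obtain ⟨hX, m1, m2⟩ := he
  simp only at hX m1 m2
  induction e1 using Sym2.ind with
  | _ a b =>
  induction e2 using Sym2.ind with
  | _ c d =>
  obtain ⟨A1, rfl⟩ := Multiset.exists_cons_of_mem m1
  obtain ⟨hab, hcd, hac, had, hbc, hbd⟩ := hX.ne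
  have m2' : s(c, d) ∈ A1 := by
    rcases Multiset.mem_cons.1 m2 with h | h
    · rw [h] at hX; exact absurd hX (not_cross_self _)
    · exact h
  obtain ⟨U, rfl⟩ := Multiset.exists_cons_of_mem m2'
  have hab' := hA.2.1 s(a, b) (by simp)
  have hcd' := hA.2.1 s(c, d) (by simp)
  simp only [Sym2.mem_iff] at hab' hcd'
  have ha := hab'.2 a (by simp)
  have hb := hab'.2 b (by simp)
  have hc := hcd'.2 c (by simp)
  have hd := hcd'.2 d (by simp)
  have q1 := hQ s(a, b) (by simp)
  have q2 := hQ s(c, d) (by simp)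
  simp only [Sym2.mem_iff, forall_eq_or_imp, forall_eq] at q1 q2
  simp only [Multiset.cons_add] at hA
  rcases hA.flip hab hcd hac had hbc hbd with h | h
  · refine ⟨s(a, c) ::ₘ s(b, d) ::ₘ U, ⟨by simpa only [Multiset.cons_add] using hA, hQ⟩,
      ⟨by simpa only [Multiset.cons_add] using h, ?_⟩, hX, a, b, c, d, U, rfl, rfl,
      hX.not_cross hP ha hb hc hd, rfl, rfl⟩
    intro s hs p hp
    simp only [Multiset.mem_cons] at hs
    rcases hs with rfl | rfl | hs
    · rcases Sym2.mem_iff.1 hp with rfl | rfl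
      exacts [q1.1, q2.1]
    · rcases Sym2.mem_iff.1 hp with rfl | rfl
      exacts [q1.2, q2.2]
    · exact hQ s (by simp [hs]) p hp
  · have hX' : Cross s(a, b) s(d, c) := by rw [Sym2.eq_swap (a := d)]; exact hX
    refine ⟨s(a, d) ::ₘ s(b, c) ::ₘ U, ⟨by simpa only [Multiset.cons_add] using hA, hQ⟩,
      ⟨by simpa only [Multiset.cons_add] using h, ?_⟩, hX, a, b, d, c, U, rfl, Sym2.eq_swap,
      hX'.not_cross hP ha hb hd hc, by rw [Sym2.eq_swap (a := d)], rfl⟩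
    intro s hs p hp
    simp only [Multiset.mem_cons] at hs
    rcases hs with rfl | rfl | hs
    · rcases Sym2.mem_iff.1 hp with rfl | rfl
      exacts [q1.1, q2.2]
    · rcases Sym2.mem_iff.1 hp with rfl | rfl
      exacts [q1.2, q2.1]
    · exact hQ s (by simp [hs]) p hp

/-! ### The untangling game -/

/-- The removal player can force every sequence of flips from `S` to reach `G` after at most `k`
flips, whichever segments are inserted. -/
def WinTo (V G : Multiset Seg → Prop) : ℕ → Multiset Seg → Prop
  | 0, S => G S
  | k + 1, S => G S ∨ ∃ e, IsCrossing S e ∧ (∃ S', FlipAt V e S S') ∧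
      ∀ S', FlipAt V e S S' → WinTo V G k S'

lemma WinTo.of_mem {V G : Multiset Seg → Prop} {S : Multiset Seg} (h : G S) (k : ℕ) :
    WinTo V G k S := by
  cases k with
  | zero => exact h
  | succ k => exact Or.inl h

lemma WinTo.mono {V G : Multiset Seg → Prop} {k m : ℕ} {S : Multiset Seg} (h : WinTo V G k S)
    (hkm : k ≤ m) : WinTo V G m S := by
  induction k generalizing m S with
  | zero => exact WinTo.of_mem h m
  | succ k ih =>
    obtain ⟨m, rfl⟩ : ∃ m', m = m' + 1 := ⟨m - 1, by omega⟩
    rcases h with h | ⟨e, h1, h2, h3⟩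
    · exact Or.inl h
    · exact Or.inr ⟨e, h1, h2, fun S' hS' => ih (h3 S' hS') (by omega)⟩

lemma WinTo.trans {V G G' : Multiset Seg → Prop} {k m : ℕ} {S : Multiset Seg} (h : WinTo V G k S)
    (hS : V S) (hG : ∀ S, V S → G S → WinTo V G' m S) : WinTo V G' (k + m) S := by
  induction k generalizing S with
  | zero => rw [zero_add]; exact hG S hS h
  | succ k ih =>
    rcases h with h | ⟨e, h1, h2, h3⟩
    · exact (hG S hS h).mono (by omega)
    · rw [Nat.succ_add]
      exact Or.inr ⟨e, h1, h2, fun S' hS' => ih (h3 S' hS') hS'.2.1⟩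

/-- No two segments of `S` cross. -/
def CrossingFree (S : Multiset Seg) : Prop := ¬ ∃ e, IsCrossing S e

lemma FlipAt.isCrossing {V : Multiset Seg → Prop} {e : Seg × Seg} {S S' : Multiset Seg}
    (h : FlipAt V e S S') : IsCrossing S e := by
  obtain ⟨h1, h2, h3, a', b', c', d', U, e1, e2, -, e3, e4⟩ := h
  exact ⟨h3, by rw [e1, e3]; simp, by rw [e2, e3]; simp⟩

lemma hasFlipSeq_succ_iff {V : Multiset Seg → Prop} {ρ : Multiset Seg → Seg × Seg}
    {S : Multiset Seg} {k : ℕ} :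
    HasFlipSeq V ρ S (k + 1) ↔ ∃ S', FlipAt V (ρ S) S S' ∧ HasFlipSeq V ρ S' k := by
  constructor
  · rintro ⟨σ, rfl, h⟩
    exact ⟨σ 1, h 0 (by omega), fun i => σ (i + 1), rfl, fun i hi => h (i + 1) (by omega)⟩
  · rintro ⟨S', h1, σ, rfl, h⟩
    refine ⟨fun i => Nat.casesOn i S σ, rfl, ?_⟩
    intro i hi
    cases i with
    | zero => exact h1
    | succ i => exact h i (by omega)

lemma hasFlipSeq_zero (V : Multiset Seg → Prop) (ρ : Multiset Seg → Seg × Seg)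
    (S : Multiset Seg) : HasFlipSeq V ρ S 0 :=
  ⟨fun _ => S, rfl, by simp⟩

lemma HasFlipSeq.le_longest {V : Multiset Seg → Prop} {ρ : Multiset Seg → Seg × Seg}
    {S : Multiset Seg} {k : ℕ} (h : HasFlipSeq V ρ S k) (hS : V S) : (k : ℕ∞) ≤ longest V ρ :=
  le_iSup₂_of_le S hS (le_iSup₂_of_le k h le_rfl)

/-- If every vertex can be untangled within `N` flips, then a single strategy does it: it removes a
pair that minimizes the number of flips still needed. -/
lemma removalValue_le_of_winTo {V : Multiset Seg → Prop} {N : ℕ}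
    (h : ∀ S, V S → WinTo V CrossingFree N S) : removalValue V ≤ N := by
  have key : ∀ S, ∃ e, V S → (∃ e, IsCrossing S e) → IsCrossing S e ∧ (∃ S', FlipAt V e S S') ∧
      ∀ j, WinTo V CrossingFree j S → ∃ i < j, ∀ S', FlipAt V e S S' →
        WinTo V CrossingFree i S' := by
    classical
    intro S
    by_cases hS : V S ∧ ∃ e, IsCrossing S e
    · obtain ⟨hS, hX⟩ := hS
      have hex : ∃ j, WinTo V CrossingFree j S := ⟨N, h S hS⟩
      have hspec := Nat.find_spec hex
      have hmin : ∀ j, WinTo V CrossingFree j S → Nat.find hex ≤ j := fun j hj =>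
        Nat.find_min' hex hj
      generalize Nat.find hex = j₀ at hspec hmin
      cases j₀ with
      | zero => exact absurd hX hspec
      | succ i =>
        rcases hspec with h0 | ⟨e, h1, h2, h3⟩
        · exact absurd hX h0
        · exact ⟨e, fun _ _ => ⟨h1, h2, fun j hj => ⟨i, hmin j hj, h3⟩⟩⟩
    · exact ⟨(s(0, 0), s(0, 0)), fun h1 h2 => absurd ⟨h1, h2⟩ hS⟩
  choose ρ hρ using key
  refine iInf₂_le_of_le ρ (fun S hS hX => ⟨(hρ S hS hX).1, (hρ S hS hX).2.1⟩) ?_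
  have bound : ∀ k S j, WinTo V CrossingFree j S → HasFlipSeq V ρ S k → k ≤ j := by
    intro k
    induction k with
    | zero => intros; omega
    | succ k ih =>
      intro S j hj hk
      obtain ⟨S', h1, h2⟩ := hasFlipSeq_succ_iff.1 hk
      obtain ⟨i, hi, h3⟩ := (hρ S h1.1 ⟨_, h1.isCrossing⟩).2.2 j hj
      have := ih S' i (h3 S' h1) h2
      omega
  refine iSup₂_le fun S hS => iSup₂_le fun k hk => ?_
  exact_mod_cast bound k S N (h S hS) hk

lemma exists_optimal_strategy {V : Multiset Seg → Prop} (h : ∃ ρ, IsRemovalStrategy V ρ) :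
    ∃ ρ, IsRemovalStrategy V ρ ∧ longest V ρ = removalValue V := by
  obtain ⟨ρ₀, h₀⟩ := h
  obtain ⟨_, ⟨ρ, hρ, rfl⟩, hmin⟩ := wellFounded_lt.has_min
    {x : ℕ∞ | ∃ ρ, IsRemovalStrategy V ρ ∧ longest V ρ = x} ⟨_, ρ₀, h₀, rfl⟩
  refine ⟨ρ, hρ, le_antisymm (le_iInf₂ fun ρ' hρ' => ?_) (iInf₂_le ρ hρ)⟩
  exact not_lt.1 (hmin _ ⟨ρ', hρ', rfl⟩)

/-- The segment `s` crosses a segment of `A`. -/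
def Crossed (A : Multiset Seg) (s : Seg) : Prop := ∃ s' ∈ A, Cross s s'

open Classical in
/-- The number of segments of `A` that take part in a crossing. -/
noncomputable def crossedCard (A : Multiset Seg) : ℕ := Multiset.card (A.filter (Crossed A))

lemma crossedCard_le (A : Multiset Seg) : crossedCard A ≤ Multiset.card A := by
  classical
  exact Multiset.card_le_card (Multiset.filter_le _ _)

lemma crossingFree_of_crossedCard_eq_zero {A : Multiset Seg} (h : crossedCard A = 0) :
    CrossingFree A := by
  classical
  rintro ⟨e, h1, h2, h3⟩
  unfold crossedCard at h
  rw [Multiset.card_eq_zero, Multiset.filter_eq_nil] at h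
  exact h e.1 h2 ⟨e.2, h3, h1⟩

/-- If the number of crossed segments can be decreased within `r` flips from everywhere, then `u`
crossed segments can be untangled within `u * r` flips. -/
lemma winTo_of_rounds {V : Multiset Seg → Prop} {r : ℕ}
    (h : ∀ A, V A → (∃ e, IsCrossing A e) →
      WinTo V (fun A' => crossedCard A' < crossedCard A) r A) (u : ℕ) :
    ∀ A, V A → crossedCard A ≤ u → WinTo V CrossingFree (u * r) A := by
  induction u with
  | zero =>
    intro A _ hu
    exact WinTo.of_mem (crossingFree_of_crossedCard_eq_zero (by omega)) _
  | succ u ih =>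
    intro A hA hu
    by_cases hX : ∃ e, IsCrossing A e
    · rw [Nat.succ_mul, add_comm]
      exact (h A hA hX).trans hA fun A' hA' hlt => ih A' hA' (by omega)
    · exact WinTo.of_mem hX _

/-- If uncrossed segments stay uncrossed, a flip does not increase the number of crossed segments,
and it decreases this number if one of the inserted segments is uncrossed. -/
lemma crossedCard_flip {s₁ s₂ s₃ s₄ : Seg} {U : Multiset Seg} (hX : Cross s₁ s₂)
    (hU : ∀ s ∈ U, ¬ Crossed (s₁ ::ₘ s₂ ::ₘ U) s → ¬ Crossed (s₃ ::ₘ s₄ ::ₘ U) s) :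
    crossedCard (s₃ ::ₘ s₄ ::ₘ U) ≤ crossedCard (s₁ ::ₘ s₂ ::ₘ U) ∧
    (¬ Crossed (s₃ ::ₘ s₄ ::ₘ U) s₃ ∨ ¬ Crossed (s₃ ::ₘ s₄ ::ₘ U) s₄ →
      crossedCard (s₃ ::ₘ s₄ ::ₘ U) < crossedCard (s₁ ::ₘ s₂ ::ₘ U)) := by
  classical
  have h1 : Crossed (s₁ ::ₘ s₂ ::ₘ U) s₁ := ⟨s₂, by simp, hX⟩
  have h2 : Crossed (s₁ ::ₘ s₂ ::ₘ U) s₂ := ⟨s₁, by simp, hX.symm⟩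
  have hle : Multiset.card (U.filter (Crossed (s₃ ::ₘ s₄ ::ₘ U))) ≤
      Multiset.card (U.filter (Crossed (s₁ ::ₘ s₂ ::ₘ U))) := by
    apply Multiset.card_le_card
    rw [Multiset.le_filter]
    refine ⟨Multiset.filter_le _ _, fun s hs => ?_⟩
    rw [Multiset.mem_filter] at hs
    by_contra hcon
    exact hU s hs.1 hcon hs.2
  have e : crossedCard (s₁ ::ₘ s₂ ::ₘ U) =
      Multiset.card (U.filter (Crossed (s₁ ::ₘ s₂ ::ₘ U))) + 1 + 1 := by
    unfold crossedCard
    rw [Multiset.filter_cons_of_pos _ h1, Multiset.filter_cons_of_pos _ h2, Multiset.card_cons,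
      Multiset.card_cons]
  rw [e]
  by_cases h3 : Crossed (s₃ ::ₘ s₄ ::ₘ U) s₃ <;> by_cases h4 : Crossed (s₃ ::ₘ s₄ ::ₘ U) s₄
  · have e' : crossedCard (s₃ ::ₘ s₄ ::ₘ U) =
        Multiset.card (U.filter (Crossed (s₃ ::ₘ s₄ ::ₘ U))) + 1 + 1 := by
      unfold crossedCard
      rw [Multiset.filter_cons_of_pos _ h3, Multiset.filter_cons_of_pos _ h4, Multiset.card_cons,
        Multiset.card_cons]
    exact ⟨by omega, fun h => by tauto⟩
  · have e' : crossedCard (s₃ ::ₘ s₄ ::ₘ U) =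
        Multiset.card (U.filter (Crossed (s₃ ::ₘ s₄ ::ₘ U))) + 1 := by
      unfold crossedCard
      rw [Multiset.filter_cons_of_pos _ h3, Multiset.filter_cons_of_neg _ h4, Multiset.card_cons]
    exact ⟨by omega, fun _ => by omega⟩
  · have e' : crossedCard (s₃ ::ₘ s₄ ::ₘ U) =
        Multiset.card (U.filter (Crossed (s₃ ::ₘ s₄ ::ₘ U))) + 1 := by
      unfold crossedCard
      rw [Multiset.filter_cons_of_neg _ h3, Multiset.filter_cons_of_pos _ h4, Multiset.card_cons]
    exact ⟨by omega, fun _ => by omega⟩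
  · have e' : crossedCard (s₃ ::ₘ s₄ ::ₘ U) =
        Multiset.card (U.filter (Crossed (s₃ ::ₘ s₄ ::ₘ U))) := by
      unfold crossedCard
      rw [Multiset.filter_cons_of_neg _ h3, Multiset.filter_cons_of_neg _ h4]
    exact ⟨by omega, fun _ => by omega⟩

/-! ### Ears of a set of chords -/

/-- All segments of `A` have their endpoints in `C`. -/
def ChordsIn (C : Finset Pt) (A : Multiset Seg) : Prop := ∀ s ∈ A, ∀ p ∈ s, p ∈ C

lemma ChordsIn.left {C : Finset Pt} {A : Multiset Seg} (h : ChordsIn C A) {x y : Pt}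
    (hs : s(x, y) ∈ A) : x ∈ C := h _ hs x (by simp)

lemma ChordsIn.right {C : Finset Pt} {A : Multiset Seg} (h : ChordsIn C A) {x y : Pt}
    (hs : s(x, y) ∈ A) : y ∈ C := h _ hs y (by simp)

/-- The segment `b d` of `A` crosses the chord `a c`, and `b` is its endpoint between `a` and `c`
in the hull order. -/
def Piercing (f : Pt → ℕ) (A : Multiset Seg) (a c b d : Pt) : Prop :=
  s(b, d) ∈ A ∧ f a < f b ∧ f b < f c ∧ (f d < f a ∨ f c < f d)

/-- The segment `a c` of `A` cuts off an ear: all other segments of `A` with endpoints in the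
interval from `a` to `c` are uncrossed. At most `u` segments of `A` are crossed, and fewer if `a c`
is uncrossed, that is, not pierced. -/
structure Ear (f : Pt → ℕ) (A : Multiset Seg) (a c : Pt) (u : ℕ) : Prop where
  mem : s(a, c) ∈ A
  lt : f a < f c
  inner : ∀ x y, s(x, y) ∈ A → f a ≤ f x → f x < f y → f y ≤ f c → (f a < f x ∨ f y < f c) →
    ¬ Crossed A s(x, y)
  card_le : crossedCard A ≤ u
  card_lt : (∀ b d, ¬ Piercing f A a c b d) → crossedCard A < u

variable {C : Finset Pt} {f : Pt → ℕ}

lemma Piercing.cross (hf : HullOrder C f) (hG : GeneralPosition C) {A : Multiset Seg}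
    (hA : ChordsIn C A) {a b c d : Pt} (hac : s(a, c) ∈ A) (h : Piercing f A a c b d) :
    Cross s(a, c) s(b, d) := by
  obtain ⟨h1, h2, h3, h4⟩ := h
  rw [hf.cross_iff hG (hA.left hac) (hA.right hac) (hA.left h1) (hA.right h1)]
  unfold Alt Btw Out
  omega

lemma crossed_iff_piercing (hf : HullOrder C f) (hG : GeneralPosition C) {A : Multiset Seg}
    (hA : ChordsIn C A) {a c : Pt} (hac : s(a, c) ∈ A) (hlt : f a < f c) :
    Crossed A s(a, c) ↔ ∃ b d, Piercing f A a c b d := by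
  constructor
  · rintro ⟨s, hs, hX⟩
    induction s using Sym2.ind with
    | _ x y =>
      have := (hf.cross_iff hG (hA.left hac) (hA.right hac) (hA.left hs) (hA.right hs)).1 hX
      unfold Alt Btw Out at this
      by_cases hx : f a < f x ∧ f x < f c
      · exact ⟨x, y, hs, hx.1, hx.2, by omega⟩
      · exact ⟨y, x, by rwa [Sym2.eq_swap], by omega, by omega, by omega⟩
  · rintro ⟨b, d, h⟩
    exact ⟨s(b, d), h.1, h.cross hf hG hA hac⟩

/-- A segment that crosses neither diagonal of a convex quadrilateral does not cross its sides. -/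
lemma not_cross_of_flip (hf : HullOrder C f) (hG : GeneralPosition C) {x y a b c d : Pt}
    (hx : x ∈ C) (hy : y ∈ C) (ha : a ∈ C) (hb : b ∈ C) (hc : c ∈ C) (hd : d ∈ C)
    (h : Cross s(a, c) s(b, d)) (h1 : ¬ Cross s(x, y) s(a, c)) (h2 : ¬ Cross s(x, y) s(b, d)) :
    ¬ Cross s(x, y) s(a, b) := by
  rw [hf.cross_iff hG ha hc hb hd] at h
  rw [hf.cross_iff hG hx hy ha hc] at h1
  rw [hf.cross_iff hG hx hy hb hd] at h2
  rw [hf.cross_iff hG hx hy ha hb]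
  have i1 := hf.ne (a := x) (b := y) hx hy
  unfold Alt Btw Out at *
  omega

lemma not_crossed_of_flip (hf : HullOrder C f) (hG : GeneralPosition C) {a b c d : Pt}
    {U : Multiset Seg} (hA : ChordsIn C (s(a, c) ::ₘ s(b, d) ::ₘ U))
    (h : Cross s(a, c) s(b, d)) {s : Seg} (hs : s ∈ U)
    (h1 : ¬ Crossed (s(a, c) ::ₘ s(b, d) ::ₘ U) s) :
    ¬ Crossed (s(a, b) ::ₘ s(c, d) ::ₘ U) s := by
  rintro ⟨s', hs', hX⟩
  have ha : a ∈ C := hA.left (x := a) (y := c) (by simp)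
  have hc : c ∈ C := hA.right (x := a) (y := c) (by simp)
  have hb : b ∈ C := hA.left (x := b) (y := d) (by simp)
  have hd : d ∈ C := hA.right (x := b) (y := d) (by simp)
  induction s using Sym2.ind with
  | _ x y =>
    have hx : x ∈ C := hA.left (x := x) (y := y) (by simp [hs])
    have hy : y ∈ C := hA.right (x := x) (y := y) (by simp [hs])
    have n1 : ¬ Cross s(x, y) s(a, c) := fun h => h1 ⟨_, by simp, h⟩
    have n2 : ¬ Cross s(x, y) s(b, d) := fun h => h1 ⟨_, by simp, h⟩
    simp only [Multiset.mem_cons] at hs'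
    rcases hs' with rfl | rfl | hs'
    · exact not_cross_of_flip hf hG hx hy ha hb hc hd h n1 n2 hX
    · refine not_cross_of_flip hf hG hx hy hc hd ha hb ?_ ?_ ?_ hX
      · rwa [Sym2.eq_swap, Sym2.eq_swap (a := d)]
      · rwa [Sym2.eq_swap (a := c)]
      · rwa [Sym2.eq_swap (a := d)]
    · exact h1 ⟨s', by simp [hs'], hX⟩

/-- Flipping the chord `a c` of an ear with a piercing segment `b d` such that `a b` is inserted
gives the ear cut off by `a b`, which is pierced by fewer segments. -/
lemma Ear.left (hf : HullOrder C f) (hG : GeneralPosition C) {a b c d : Pt} {U : Multiset Seg}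
    {u : ℕ} (hA : ChordsIn C (s(a, c) ::ₘ s(b, d) ::ₘ U))
    (hE : Ear f (s(a, c) ::ₘ s(b, d) ::ₘ U) a c u)
    (hb : Piercing f (s(a, c) ::ₘ s(b, d) ::ₘ U) a c b d)
    (hA' : ChordsIn C (s(a, b) ::ₘ s(c, d) ::ₘ U)) :
    Ear f (s(a, b) ::ₘ s(c, d) ::ₘ U) a b u ∧
      ∀ b' d', Piercing f (s(a, b) ::ₘ s(c, d) ::ₘ U) a b b' d' →
        Piercing f (s(a, c) ::ₘ s(b, d) ::ₘ U) a c b' d' ∧ f b' < f b := by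
  have hX := hb.cross hf hG hA hE.mem
  obtain ⟨-, h2, h3, h4⟩ := hb
  have hU := fun s (hs : s ∈ U) => not_crossed_of_flip hf hG hA hX hs
  obtain ⟨c1, c2⟩ := crossedCard_flip hX hU
  refine ⟨⟨by simp, h2, ?_, c1.trans hE.card_le, fun hno => ?_⟩, ?_⟩
  · intro x y hxy e1 e2 e3 e4
    simp only [Multiset.mem_cons] at hxy
    rcases hxy with hxy | hxy | hxy
    · rcases Sym2.eq_iff.1 hxy with ⟨rfl, rfl⟩ | ⟨rfl, rfl⟩ <;> omega
    · rcases Sym2.eq_iff.1 hxy with ⟨rfl, rfl⟩ | ⟨rfl, rfl⟩ <;> omega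
    · exact hU _ hxy (hE.inner x y (by simp [hxy]) e1 e2 (by omega) (by omega))
  · refine (c2 (Or.inl ?_)).trans_le hE.card_le
    rw [crossed_iff_piercing hf hG hA' (by simp) h2]
    rintro ⟨b', d', h⟩
    exact hno b' d' h
  · rintro b' d' ⟨e1, e2, e3, e4⟩
    refine ⟨⟨?_, e2, by omega, ?_⟩, e3⟩
    · simp only [Multiset.mem_cons] at e1
      rcases e1 with e1 | e1 | e1
      · rcases Sym2.eq_iff.1 e1 with ⟨rfl, rfl⟩ | ⟨rfl, rfl⟩ <;> omega
      · rcases Sym2.eq_iff.1 e1 with ⟨rfl, rfl⟩ | ⟨rfl, rfl⟩ <;> omega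
      · simp [e1]
    · by_contra hcon
      simp only [Multiset.mem_cons] at e1
      rcases e1 with e1 | e1 | e1
      · rcases Sym2.eq_iff.1 e1 with ⟨rfl, rfl⟩ | ⟨rfl, rfl⟩ <;> omega
      · rcases Sym2.eq_iff.1 e1 with ⟨rfl, rfl⟩ | ⟨rfl, rfl⟩ <;> omega
      · -- the segment `b' d'` would be an inner segment that crosses `b d`
        refine hE.inner b' d' (by simp [e1]) (by omega) (by omega) (by omega) (by omega)
          ⟨s(b, d), by simp, ?_⟩
        rw [hf.cross_iff hG (hA'.left (x := b') (y := d') (by simp [e1]))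
          (hA'.right (x := b') (y := d') (by simp [e1])) (hA.left (x := b) (y := d) (by simp))
          (hA.right (x := b) (y := d) (by simp))]
        unfold Alt Btw Out
        omega

/-- Flipping the chord `a c` of an ear with a piercing segment `b d` such that `b c` is inserted
gives the ear cut off by `b c`, which is pierced by fewer segments. -/
lemma Ear.right (hf : HullOrder C f) (hG : GeneralPosition C) {a b c d : Pt} {U : Multiset Seg}
    {u : ℕ} (hA : ChordsIn C (s(a, c) ::ₘ s(b, d) ::ₘ U))
    (hE : Ear f (s(a, c) ::ₘ s(b, d) ::ₘ U) a c u)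
    (hb : Piercing f (s(a, c) ::ₘ s(b, d) ::ₘ U) a c b d)
    (hA' : ChordsIn C (s(b, c) ::ₘ s(a, d) ::ₘ U)) :
    Ear f (s(b, c) ::ₘ s(a, d) ::ₘ U) b c u ∧
      ∀ b' d', Piercing f (s(b, c) ::ₘ s(a, d) ::ₘ U) b c b' d' →
        Piercing f (s(a, c) ::ₘ s(b, d) ::ₘ U) a c b' d' ∧ f b < f b' := by
  have hX := hb.cross hf hG hA hE.mem
  obtain ⟨-, h2, h3, h4⟩ := hb
  have hU : ∀ s ∈ U, ¬ Crossed (s(a, c) ::ₘ s(b, d) ::ₘ U) s →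
      ¬ Crossed (s(b, c) ::ₘ s(a, d) ::ₘ U) s := by
    intro s hs h
    rw [Sym2.eq_swap (a := b) (b := c)]
    rw [Sym2.eq_swap (a := a)] at h
    rw [Sym2.eq_swap (a := a)] at hX hA
    exact not_crossed_of_flip hf hG hA hX hs h
  obtain ⟨c1, c2⟩ := crossedCard_flip hX hU
  refine ⟨⟨by simp, h3, ?_, c1.trans hE.card_le, fun hno => ?_⟩, ?_⟩
  · intro x y hxy e1 e2 e3 e4
    simp only [Multiset.mem_cons] at hxy
    rcases hxy with hxy | hxy | hxy
    · rcases Sym2.eq_iff.1 hxy with ⟨rfl, rfl⟩ | ⟨rfl, rfl⟩ <;> omega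
    · rcases Sym2.eq_iff.1 hxy with ⟨rfl, rfl⟩ | ⟨rfl, rfl⟩ <;> omega
    · exact hU _ hxy (hE.inner x y (by simp [hxy]) (by omega) e2 e3 (by omega))
  · refine (c2 (Or.inl ?_)).trans_le hE.card_le
    rw [crossed_iff_piercing hf hG hA' (by simp) h3]
    rintro ⟨b', d', h⟩
    exact hno b' d' h
  · rintro b' d' ⟨e1, e2, e3, e4⟩
    refine ⟨⟨?_, by omega, e3, ?_⟩, e2⟩
    · simp only [Multiset.mem_cons] at e1
      rcases e1 with e1 | e1 | e1
      · rcases Sym2.eq_iff.1 e1 with ⟨rfl, rfl⟩ | ⟨rfl, rfl⟩ <;> omega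
      · rcases Sym2.eq_iff.1 e1 with ⟨rfl, rfl⟩ | ⟨rfl, rfl⟩ <;> omega
      · simp [e1]
    · by_contra hcon
      simp only [Multiset.mem_cons] at e1
      rcases e1 with e1 | e1 | e1
      · rcases Sym2.eq_iff.1 e1 with ⟨rfl, rfl⟩ | ⟨rfl, rfl⟩ <;> omega
      · rcases Sym2.eq_iff.1 e1 with ⟨rfl, rfl⟩ | ⟨rfl, rfl⟩ <;> omega
      · -- the segment `d' b'` would be an inner segment that crosses `b d`
        refine hE.inner d' b' (by rw [Sym2.eq_swap (a := d')]; simp [e1]) (by omega) (by omega)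
          (by omega) (by omega) ⟨s(b, d), by simp, ?_⟩
        rw [hf.cross_iff hG (hA'.right (x := b') (y := d') (by simp [e1]))
          (hA'.left (x := b') (y := d') (by simp [e1])) (hA.left (x := b) (y := d) (by simp))
          (hA.right (x := b) (y := d) (by simp))]
        unfold Alt Btw Out
        omega

/-- A crossed segment that spans a minimal interval of the hull order cuts off an ear. -/
lemma exists_ear (hf : HullOrder C f) (hG : GeneralPosition C) {A : Multiset Seg}
    (hA : ChordsIn C A) (hX : ∃ e, IsCrossing A e) :
    ∃ a c, Ear f A a c (crossedCard A) := by
  have hex : ∃ k a c, s(a, c) ∈ A ∧ f a < f c ∧ Crossed A s(a, c) ∧ f c - f a = k := by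
    obtain ⟨⟨e1, e2⟩, hX, m1, m2⟩ := hX
    induction e1 using Sym2.ind with
    | _ a c =>
      have hne := hf.ne (hA.left m1) (hA.right m1) (by
        induction e2 using Sym2.ind with
        | _ x y => exact hX.ne.1)
      rcases hne.lt_or_gt with h | h
      · exact ⟨_, a, c, m1, h, ⟨e2, m2, hX⟩, rfl⟩
      · simp only at m1 hX
        rw [Sym2.eq_swap] at m1 hX
        exact ⟨_, c, a, m1, h, ⟨e2, m2, hX⟩, rfl⟩
  classical
  obtain ⟨a, c, h1, h2, h3, h4⟩ := Nat.find_spec hex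
  refine ⟨a, c, h1, h2, ?_, le_rfl, ?_⟩
  · intro x y hxy e1 e2 e3 e4 hXy
    exact Nat.find_min hex (m := f y - f x) (by omega) ⟨x, y, hxy, e2, hXy, rfl⟩
  · intro hno
    obtain ⟨b, d, h⟩ := (crossed_iff_piercing hf hG hA h1 h2).1 h3
    exact absurd h (hno b d)

/-! ### Untangling chords of a convex point set -/

section

variable {C : Finset Pt} {f : Pt → ℕ} {V : Multiset Seg → Prop}

/-- To win from an ear by removing its chord and a piercing segment, it suffices to win from the
smaller ears that result from the two possible insertions. -/
lemma Ear.winTo_succ (hf : HullOrder C f) (hG : GeneralPosition C) (hV : ∀ A, V A → ChordsIn C A)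
    (hflip : ∀ A e, V A → IsCrossing A e → ∃ A', FlipAt V e A A') {G : Multiset Seg → Prop}
    {A : Multiset Seg} {a b c d : Pt} {u k : ℕ} (hA : V A) (hE : Ear f A a c u)
    (hb : Piercing f A a c b d)
    (hl : ∀ U, A = s(a, c) ::ₘ s(b, d) ::ₘ U → V (s(a, b) ::ₘ s(c, d) ::ₘ U) →
      Ear f (s(a, b) ::ₘ s(c, d) ::ₘ U) a b u →
      (∀ b' d', Piercing f (s(a, b) ::ₘ s(c, d) ::ₘ U) a b b' d' →
        Piercing f A a c b' d' ∧ f b' < f b) →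
      WinTo V G k (s(a, b) ::ₘ s(c, d) ::ₘ U))
    (hr : ∀ U, A = s(a, c) ::ₘ s(b, d) ::ₘ U → V (s(b, c) ::ₘ s(a, d) ::ₘ U) →
      Ear f (s(b, c) ::ₘ s(a, d) ::ₘ U) b c u →
      (∀ b' d', Piercing f (s(b, c) ::ₘ s(a, d) ::ₘ U) b c b' d' →
        Piercing f A a c b' d' ∧ f b < f b') →
      WinTo V G k (s(b, c) ::ₘ s(a, d) ::ₘ U)) :
    WinTo V G (k + 1) A := by
  have hX := hb.cross hf hG (hV A hA) hE.mem
  have hcr : IsCrossing A (s(a, c), s(b, d)) := ⟨hX, hE.mem, hb.1⟩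
  refine Or.inr ⟨_, hcr, hflip A _ hA hcr, fun A' hA' => ?_⟩
  obtain ⟨-, h2, -, U, rfl, h4⟩ := hA'.cases
  rcases h4 with rfl | rfl
  · obtain ⟨h5, h6⟩ := Ear.left hf hG (hV _ hA) hE hb (hV _ h2)
    exact hl U rfl h2 h5 h6
  · rw [Multiset.cons_swap, Sym2.eq_swap (a := c)] at h2 ⊢
    obtain ⟨h5, h6⟩ := Ear.right hf hG (hV _ hA) hE hb (hV _ h2)
    exact hr U rfl h2 h5 h6

/-- An ear is won with one flip if its first piercing segment forces the insertion of the shorter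
segment: that segment is uncrossed. -/
lemma Ear.winTo_one (hf : HullOrder C f) (hG : GeneralPosition C) (hV : ∀ A, V A → ChordsIn C A)
    (hflip : ∀ A e, V A → IsCrossing A e → ∃ A', FlipAt V e A A')
    {A : Multiset Seg} {a c : Pt} {u : ℕ} (hA : V A) (hE : Ear f A a c u)
    (hforce : ∀ b d U, Piercing f A a c b d → A = s(a, c) ::ₘ s(b, d) ::ₘ U →
      ¬ V (s(b, c) ::ₘ s(a, d) ::ₘ U)) :
    WinTo V (fun A' => crossedCard A' < u) 1 A := by
  by_cases hno : ∀ b d, ¬ Piercing f A a c b d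
  · exact WinTo.of_mem (hE.card_lt hno) 1
  · push Not at hno
    have hex : ∃ k b d, Piercing f A a c b d ∧ f b = k := by
      obtain ⟨b, d, h⟩ := hno
      exact ⟨_, b, d, h, rfl⟩
    classical
    obtain ⟨b, d, hb, hk⟩ := Nat.find_spec hex
    refine hE.winTo_succ hf hG hV hflip (k := 0) hA hb ?_ ?_
    · intro U _ _ hE' hP
      refine hE'.card_lt fun b' d' h => ?_
      obtain ⟨h1, h2⟩ := hP b' d' h
      exact Nat.find_min hex (m := f b') (by omega) ⟨b', d', h1, rfl⟩
    · intro U hU h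
      exact absurd h (hforce b d U hb hU)

/-- Among the piercing segments with a property `T`, if there are any, one can be chosen whose
inner endpoint comes last. -/
lemma exists_last_piercing {A : Multiset Seg} {a c : Pt} {T : Pt → Pt → Prop}
    (h : ∃ b d, Piercing f A a c b d ∧ T b d) :
    ∃ b d, Piercing f A a c b d ∧ T b d ∧
      ∀ b' d', Piercing f A a c b' d' → f b < f b' → ¬ T b' d' := by
  have hex : ∃ k b d, Piercing f A a c b d ∧ T b d ∧ f c - f b = k := by
    obtain ⟨b, d, h⟩ := h
    exact ⟨_, b, d, h.1, h.2, rfl⟩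
  classical
  obtain ⟨b, d, h1, h2, h3⟩ := Nat.find_spec hex
  refine ⟨b, d, h1, h2, fun b' d' h4 h5 h6 => ?_⟩
  exact Nat.find_min hex (m := f c - f b') (by have := h4.2.2.1; omega) ⟨b', d', h4, h6, rfl⟩

/-- A finite set with an injective numbering contains an element with any prescribed number of
smaller elements. -/
lemma exists_rank {J : Finset Pt} (hJ : ∀ x ∈ J, ∀ y ∈ J, f x = f y → x = y) {k : ℕ}
    (hk : k < J.card) : ∃ b ∈ J, (J.filter (fun x => f x < f b)).card = k := by
  have hmono : ∀ x ∈ J, ∀ y ∈ J, f x < f y →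
      (J.filter (fun z => f z < f x)).card < (J.filter (fun z => f z < f y)).card := by
    intro x hx y _ hxy
    apply Finset.card_lt_card
    refine Finset.ssubset_iff_of_subset ?_ |>.2 ⟨x, ?_, ?_⟩
    · intro z hz
      rw [Finset.mem_filter] at hz ⊢
      exact ⟨hz.1, hz.2.trans hxy⟩
    · exact Finset.mem_filter.2 ⟨hx, hxy⟩
    · simp
  have hsurj := Finset.surj_on_of_inj_on_of_card_le (s := J) (t := Finset.range J.card)
    (fun b _ => (J.filter (fun x => f x < f b)).card) ?_ ?_ (by simp) k (by simpa using hk)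
  · obtain ⟨b, hb, h⟩ := hsurj
    exact ⟨b, hb, h.symm⟩
  · intro b hb
    rw [Finset.mem_range]
    apply Finset.card_lt_card
    exact Finset.filter_ssubset.2 ⟨b, hb, by simp⟩
  · intro x y hx hy hxy
    by_contra hne
    have : f x ≠ f y := fun h => hne (hJ x hx y hy h)
    rcases this.lt_or_gt with h | h
    · exact absurd (hmono x hx y hy h) (by omega)
    · exact absurd (hmono y hy x hx h) (by omega)

/-- Halving: if the piercing segments of an ear have fewer than `2 ^ r` inner endpoints, the number
of crossed segments can be decreased within `r` flips, by always removing a piercing segment with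
median inner endpoint. -/
lemma Ear.winTo_of_card_lt (hf : HullOrder C f) (hG : GeneralPosition C)
    (hV : ∀ A, V A → ChordsIn C A)
    (hflip : ∀ A e, V A → IsCrossing A e → ∃ A', FlipAt V e A A') (r : ℕ) :
    ∀ {A : Multiset Seg} {a c : Pt} {u : ℕ}, V A → Ear f A a c u → ∀ J : Finset Pt, J ⊆ C →
      (∀ b d, Piercing f A a c b d → b ∈ J) → J.card < 2 ^ r →
      WinTo V (fun A' => crossedCard A' < u) r A := by
  classical
  induction r with
  | zero =>
    intro A a c u hA hE J _ hJ hcard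
    refine hE.card_lt fun b d h => ?_
    have : J = ∅ := by rw [← Finset.card_eq_zero]; omega
    rw [this] at hJ
    exact absurd (hJ b d h) (by simp)
  | succ r ih =>
    intro A a c u hA hE J hJC hJ hcard
    by_cases hno : ∀ b d, ¬ Piercing f A a c b d
    · exact WinTo.of_mem (hE.card_lt hno) _
    push Not at hno
    obtain ⟨b₀, d₀, h₀⟩ := hno
    set J' := J.filter (fun b => ∃ d, Piercing f A a c b d) with hJ'
    have hsub : J' ⊆ J := Finset.filter_subset _ _
    have hmem : ∀ b d, Piercing f A a c b d → b ∈ J' := fun b d h =>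
      Finset.mem_filter.2 ⟨hJ b d h, d, h⟩
    have hpos : 0 < J'.card := Finset.card_pos.2 ⟨b₀, hmem _ _ h₀⟩
    have hle : J'.card ≤ J.card := Finset.card_le_card hsub
    have hinj : ∀ x ∈ J', ∀ y ∈ J', f x = f y → x = y := fun x hx y hy =>
      hf.inj x (hJC (hsub hx)) y (hJC (hsub hy))
    obtain ⟨b, hbJ, hb⟩ := exists_rank hinj (k := J'.card / 2) (by omega)
    obtain ⟨d, hbd⟩ := (Finset.mem_filter.1 hbJ).2
    have hsum : (J'.filter (fun x => f x < f b)).card + (J'.filter (fun x => f b < f x)).card <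
        J'.card := by
      rw [← Finset.card_union_of_disjoint]
      · apply Finset.card_lt_card
        refine Finset.ssubset_iff_of_subset ?_ |>.2 ⟨b, hbJ, by simp⟩
        exact Finset.union_subset (Finset.filter_subset _ _) (Finset.filter_subset _ _)
      · rw [Finset.disjoint_filter]
        intro x _ h
        omega
    rw [pow_succ] at hcard
    refine hE.winTo_succ hf hG hV hflip hA hbd ?_ ?_
    · intro U _ hA' hE' hP
      refine ih hA' hE' (J'.filter (fun x => f x < f b))
        (((Finset.filter_subset _ _).trans hsub).trans hJC) ?_ (by omega)
      intro b' d' h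
      exact Finset.mem_filter.2 ⟨hmem b' d' (hP b' d' h).1, (hP b' d' h).2⟩
    · intro U _ hA' hE' hP
      refine ih hA' hE' (J'.filter (fun x => f b < f x))
        (((Finset.filter_subset _ _).trans hsub).trans hJC) ?_ (by omega)
      intro b' d' h
      exact Finset.mem_filter.2 ⟨hmem b' d' (hP b' d' h).1, (hP b' d' h).2⟩

/-- The inner endpoints of the piercing segments belong to distinct segments of `A`. -/
lemma exists_piercing_finset {A : Multiset Seg} (hV : ChordsIn C A) {a c : Pt} :
    ∃ J : Finset Pt, J ⊆ C ∧ (∀ b d, Piercing f A a c b d → b ∈ J) ∧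
      J.card ≤ Multiset.card A := by
  classical
  refine ⟨C.filter (fun b => ∃ d, Piercing f A a c b d), Finset.filter_subset _ _, ?_, ?_⟩
  · exact fun b d h => Finset.mem_filter.2 ⟨hV.left h.1, d, h⟩
  · refine le_trans ?_ (Multiset.toFinset_card_le A)
    have hch : ∀ b, ∃ d, (∃ d, Piercing f A a c b d) → Piercing f A a c b d := by
      intro b
      by_cases h : ∃ d, Piercing f A a c b d
      · obtain ⟨d, hd⟩ := h; exact ⟨d, fun _ => hd⟩
      · exact ⟨0, fun h' => absurd h' h⟩
    choose g hg using hch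
    refine Finset.card_le_card_of_injOn (fun b => s(b, g b)) ?_ ?_
    · intro b hb
      have := hg b (Finset.mem_filter.1 (Finset.mem_coe.1 hb)).2
      simpa using this.1
    · intro b hb b' hb' heq
      have h1 := hg b (Finset.mem_filter.1 (Finset.mem_coe.1 hb)).2
      have h2 := hg b' (Finset.mem_filter.1 (Finset.mem_coe.1 hb')).2
      obtain ⟨-, h3, h4, h5⟩ := h1
      obtain ⟨-, h6, h7, h8⟩ := h2
      rcases Sym2.eq_iff.1 heq with ⟨h, -⟩ | ⟨h, h'⟩
      · exact h
      · rw [h] at h3 h4; omega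

/-- The multisets `A` of segments with endpoints in `C` that, together with `B`, form an admissible
multiset. -/
def PartState (Γ : GraphProperty) (P : Finset Pt) (col : Pt → Bool) (n : ℕ) (C : Finset Pt)
    (B : Multiset Seg) : Multiset Seg → Prop :=
  fun A => IsState Γ P col n (A + B) ∧ ∀ s ∈ A, ∀ p ∈ s, p ∈ C

section Rounds

variable {Γ : GraphProperty} {P : Finset Pt} {col : Pt → Bool} {n : ℕ} {B : Multiset Seg}

lemma PartState.chordsIn {A : Multiset Seg} (h : PartState Γ P col n C B A) : ChordsIn C A := h.2

lemma PartState.card_le {A : Multiset Seg} (h : PartState Γ P col n C B A) :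
    Multiset.card A ≤ n := by
  have := h.1.1
  rw [Multiset.card_add] at this
  omega

lemma PartState.exists_flipAt (hP : GeneralPosition P) (A : Multiset Seg) (e : Seg × Seg)
    (h : PartState Γ P col n C B A) (he : IsCrossing A e) :
    ∃ A', FlipAt (PartState Γ P col n C B) e A A' :=
  exists_flipAt_of_isCrossing hP h.1 h.2 he

/-- If every round takes at most `r` flips, at most `n * r` flips are needed. -/
lemma removalValue_le_of_rounds {r : ℕ} (h : ∀ A, PartState Γ P col n C B A →
      (∃ e, IsCrossing A e) → WinTo (PartState Γ P col n C B)
        (fun A' => crossedCard A' < crossedCard A) r A) :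
    removalValue (PartState Γ P col n C B) ≤ (n * r : ℕ) :=
  removalValue_le_of_winTo fun A hA =>
    winTo_of_rounds h n A hA ((crossedCard_le A).trans hA.card_le)

lemma removalValue_le_log (hC : ConvexPosition C) (hP : GeneralPosition P) (hCP : C ⊆ P) (m : ℕ)
    (hm : C.card ≤ m ∨ n ≤ m) :
    removalValue (PartState Γ P col n C B) ≤ (n * (Nat.log 2 m + 1) : ℕ) := by
  refine removalValue_le_of_rounds fun A hA hX => ?_
  have hG := hP.mono hCP
  obtain ⟨f, hf⟩ := exists_hullOrder hC hG
  obtain ⟨a, c, hE⟩ := exists_ear hf hG hA.chordsIn hX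
  obtain ⟨J, h1, h2, h3⟩ := exists_piercing_finset (f := f) hA.chordsIn (a := a) (c := c)
  refine hE.winTo_of_card_lt hf hG (fun A h => h.chordsIn) (PartState.exists_flipAt hP) _ hA J h1 h2
    (lt_of_le_of_lt ?_ (Nat.lt_pow_succ_log_self (by norm_num) m))
  have := Finset.card_le_card h1
  have := hA.card_le
  omega

/-- For red-blue matchings, two flips suffice to decrease the number of crossed segments: if the
inner endpoints of all piercing segments have the colour of `c`, the first of these segments is
replaced by an uncrossed one. Otherwise the piercing segment that comes last among those whose inner
endpoint has the colour of `a` leaves an ear of this kind. -/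
lemma removalValue_redBlue_le (hC : ConvexPosition C) (hP : GeneralPosition P) (hCP : C ⊆ P) :
    removalValue (PartState .redBlue P col n C B) ≤ (n * 2 : ℕ) := by
  refine removalValue_le_of_rounds fun A hA hX => ?_
  have hG := hP.mono hCP
  obtain ⟨f, hf⟩ := exists_hullOrder hC hG
  obtain ⟨a, c, hE⟩ := exists_ear hf hG hA.chordsIn hX
  have hV := fun A (h : PartState .redBlue P col n C B A) => h.chordsIn
  have hflip := PartState.exists_flipAt (Γ := .redBlue) (col := col) (n := n) (C := C) (B := B) hP
  have hcol : ∀ {A x y}, PartState .redBlue P col n C B A → s(x, y) ∈ A → col x ≠ col y :=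
    fun {A x y} h hs => (bichromatic_iff col x y).1 (h.1.2.2.2 _ (by simp [hs]))
  have level : ∀ {A a c u}, PartState .redBlue P col n C B A → Ear f A a c u →
      (∀ b d, Piercing f A a c b d → col b ≠ col a) →
      WinTo (PartState .redBlue P col n C B) (fun A' => crossedCard A' < u) 1 A := by
    intro A a c u hA hE hT
    refine hE.winTo_one hf hG hV hflip hA fun b d U hb _ hA' => ?_
    have h1 := hT b d hb
    have h2 := hcol hA hE.mem
    have h3 := hcol (x := b) (y := c) hA' (by simp)
    revert h1 h2 h3
    cases col a <;> cases col b <;> cases col c <;> simp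
  by_cases hH : ∃ b d, Piercing f A a c b d ∧ col b = col a
  · obtain ⟨b, d, hb, hba, hlast⟩ := exists_last_piercing hH
    refine hE.winTo_succ hf hG hV hflip hA hb ?_ ?_
    · intro U _ hA'
      exact absurd hba.symm (hcol (x := a) (y := b) hA' (by simp))
    · intro U _ hA' hE' hP'
      refine level hA' hE' fun b' d' h => ?_
      rw [hba]
      exact hlast b' d' (hP' b' d' h).1 (hP' b' d' h).2
  · push Not at hH
    exact (level hA hE fun b d h => hH b d h).mono (by norm_num)

end Rounds

end

/-! ### Untangling tours -/

section

variable {C : Finset Pt} {f : Pt → ℕ} {P : Finset Pt} {col : Pt → Bool} {n : ℕ}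
  {B : Multiset Seg}

/-- The segments of a tour besides the closing segment and the segment `u v`. -/
lemma IsTour.rest_eq {a c u v : Pt} {X Y : List Pt} {U : Multiset Seg}
    (h : IsTour P a c (X ++ Y) (s(a, c) ::ₘ s(u, v) ::ₘ U)) (hX : X.getLast? = some u)
    (hY : Y.head? = some v) : U = pathSegs X + pathSegs Y := by
  have := h.eq
  rw [pathSegs_append hX hY] at this
  simpa only [Multiset.cons_inj_right] using this

/-- If the tour runs through `b d` in the same direction as through the chord `a c`, then `a b`
is inserted. -/
lemma IsTour.not_isHamCycle_right {a c b d : Pt} {l : List Pt} {U : Multiset Seg}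
    (h : IsTour P a c l (s(a, c) ::ₘ s(b, d) ::ₘ U)) (hbd : [b, d] <:+: l) :
    ¬ IsHamCycle P (s(b, c) ::ₘ s(a, d) ::ₘ U) := by
  obtain ⟨X, Y, hl⟩ := hbd
  obtain rfl : l = (X ++ [b]) ++ (d :: Y) := by rw [← hl]; simp
  have := h.not_isHamCycle (u := b) (v := d) (by simp) (by simp)
  rwa [← h.rest_eq (by simp) (by simp), Multiset.cons_swap, Sym2.eq_swap (a := d)] at this

/-- If the tour runs through `b d` against the direction of the chord `a c`, then `b c` is
inserted. -/
lemma IsTour.not_isHamCycle_left {a c b d : Pt} {l : List Pt} {U : Multiset Seg}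
    (h : IsTour P a c l (s(a, c) ::ₘ s(b, d) ::ₘ U)) (hbd : [d, b] <:+: l) :
    ¬ IsHamCycle P (s(a, b) ::ₘ s(c, d) ::ₘ U) := by
  obtain ⟨X, Y, hl⟩ := hbd
  obtain rfl : l = (X ++ [d]) ++ (b :: Y) := by rw [← hl]; simp
  rw [Sym2.eq_swap (a := b)] at h
  have := h.not_isHamCycle (u := d) (v := b) (by simp) (by simp)
  rwa [← h.rest_eq (by simp) (by simp), Sym2.eq_swap, Sym2.eq_swap (a := d)] at this

/-- The tour after the insertion of `b c`, directed such that its chord is `b c`: the part after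
`b` is reversed. -/
lemma IsTour.flip_right {a c b d : Pt} {X Y : List Pt} {U : Multiset Seg}
    (h : IsTour P a c (X ++ [d] ++ b :: Y) (s(a, c) ::ₘ s(b, d) ::ₘ U)) :
    IsTour P b c (X ++ [d] ++ (b :: Y).reverse) (s(b, c) ::ₘ s(a, d) ::ₘ U) := by
  rw [Sym2.eq_swap (a := b)] at h
  have := h.two_opt (u := d) (v := b) (by simp) (by simp)
  rwa [← h.rest_eq (by simp) (by simp), Sym2.eq_swap (a := d)] at this

/-- An ear is won with one flip if the tour runs through all piercing segments outwards, that is,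
if the inner endpoint is the first one, while it runs through the chord from `a` to `c`. -/
lemma Ear.winTo_cycle_one (hf : HullOrder C f) (hG : GeneralPosition C)
    (hP : GeneralPosition P) {A : Multiset Seg} {a c : Pt} {u : ℕ} {l : List Pt}
    (hA : PartState .cycle P col n C B A) (hE : Ear f A a c u) (hl : IsTour P a c l (A + B))
    (hT : ∀ b d, Piercing f A a c b d → [b, d] <:+: l) :
    WinTo (PartState .cycle P col n C B) (fun A' => crossedCard A' < u) 1 A := by
  refine hE.winTo_one hf hG (fun A h => h.chordsIn) (PartState.exists_flipAt hP) hA ?_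
  intro b d U hb hU hA'
  rw [hU] at hl
  simp only [Multiset.cons_add] at hl
  have := hA'.1.2.2
  simp only [Multiset.cons_add] at this
  exact hl.not_isHamCycle_right (hT b d hb) this

/-- Two flips suffice if the tour first runs through piercing segments outwards only and then
inwards only: the inward segment whose inner endpoint comes last leaves an ear that is only pierced
outwards. -/
lemma Ear.winTo_cycle_two (hf : HullOrder C f) (hG : GeneralPosition C)
    (hP : GeneralPosition P) {A : Multiset Seg} {a c : Pt} {u : ℕ} {X Y : List Pt}
    (hA : PartState .cycle P col n C B A) (hE : Ear f A a c u)
    (hl : IsTour P a c (X ++ Y) (A + B))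
    (hT : ∀ b d, Piercing f A a c b d → [b, d] <:+: X ∨ [d, b] <:+: Y) :
    WinTo (PartState .cycle P col n C B) (fun A' => crossedCard A' < u) 2 A := by
  by_cases hH : ∃ b d, Piercing f A a c b d ∧ [d, b] <:+: Y
  · obtain ⟨b, d, hb, ⟨Y₁, Y₂, hY⟩, hlast⟩ := exists_last_piercing hH
    obtain rfl : Y = Y₁ ++ [d] ++ b :: Y₂ := by rw [← hY]; simp
    refine hE.winTo_succ hf hG (fun A h => h.chordsIn) (PartState.exists_flipAt hP) hA hb ?_ ?_
    · intro U hU hA'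
      have := hA'.1.2.2
      simp only [Multiset.cons_add] at this
      rw [hU] at hl
      simp only [Multiset.cons_add] at hl
      exact absurd this (hl.not_isHamCycle_left ⟨X ++ Y₁, Y₂, by simp⟩)
    · intro U hU hA' hE' hP'
      rw [hU] at hl
      simp only [Multiset.cons_add] at hl
      have hl' : IsTour P a c ((X ++ Y₁) ++ [d] ++ b :: Y₂) (s(a, c) ::ₘ s(b, d) ::ₘ (U + B)) := by
        simpa using hl
      refine Ear.winTo_cycle_one hf hG hP (l := (X ++ Y₁) ++ [d] ++ (b :: Y₂).reverse) hA' hE' ?_ ?_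
      · simp only [Multiset.cons_add]
        exact hl'.flip_right
      · intro b' d' h
        obtain ⟨h1, h2⟩ := hP' b' d' h
        rcases hT b' d' h1 with h3 | h3
        · exact h3.trans ⟨[], Y₁ ++ [d] ++ (b :: Y₂).reverse, by simp⟩
        · exact absurd h3 (hlast b' d' h1 h2)
  · push Not at hH
    refine (Ear.winTo_cycle_one hf hG hP hA hE hl fun b d h => ?_).mono (by norm_num)
    exact ((hT b d h).resolve_right (hH b d h)).trans ⟨[], Y, by simp⟩

/-- Three flips suffice for every ear of a tour. Removing the inward segment whose inner endpoint
comes last leaves outward segments only, of which those traversed later become inward ones because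
their part of the tour is reversed. -/
lemma Ear.winTo_cycle_three (hf : HullOrder C f) (hG : GeneralPosition C)
    (hP : GeneralPosition P) {A : Multiset Seg} {a c : Pt} {u : ℕ}
    (hA : PartState .cycle P col n C B A) (hE : Ear f A a c u) :
    WinTo (PartState .cycle P col n C B) (fun A' => crossedCard A' < u) 3 A := by
  obtain ⟨l, hl⟩ := IsHamCycle.exists_isTour hA.1.2.2 (a := a) (c := c)
    (Multiset.mem_add.2 (Or.inl hE.mem))
  have hdir : ∀ b d, Piercing f A a c b d → [b, d] <:+: l ∨ [d, b] <:+: l := by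
    intro b d h
    refine infix_or_infix_of_mem_pathSegs ?_
    have : s(b, d) ∈ A + B := Multiset.mem_add.2 (Or.inl h.1)
    rw [hl.eq, Multiset.mem_cons] at this
    refine this.resolve_left fun he => ?_
    obtain ⟨-, h1, h2, -⟩ := h
    rcases Sym2.eq_iff.1 he with ⟨rfl, -⟩ | ⟨rfl, -⟩ <;> omega
  by_cases hH : ∃ b d, Piercing f A a c b d ∧ [d, b] <:+: l
  · obtain ⟨b, d, hb, ⟨X, Y, hXY⟩, hlast⟩ := exists_last_piercing hH
    obtain rfl : l = X ++ [d] ++ b :: Y := by rw [← hXY]; simp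
    refine hE.winTo_succ hf hG (fun A h => h.chordsIn) (PartState.exists_flipAt hP) hA hb ?_ ?_
    · intro U hU hA'
      have := hA'.1.2.2
      simp only [Multiset.cons_add] at this
      rw [hU] at hl
      simp only [Multiset.cons_add] at hl
      exact absurd this (hl.not_isHamCycle_left ⟨X, Y, by simp⟩)
    · intro U hU hA' hE' hP'
      rw [hU] at hl
      simp only [Multiset.cons_add] at hl
      refine Ear.winTo_cycle_two hf hG hP (X := X ++ [d]) (Y := (b :: Y).reverse) hA' hE' ?_ ?_
      · simp only [Multiset.cons_add]
        exact hl.flip_right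
      · intro b' d' h
        obtain ⟨h1, h2⟩ := hP' b' d' h
        have h3 := (hdir b' d' h1).resolve_right (hlast b' d' h1 h2)
        have hb'd : b' ≠ d := by
          rintro rfl
          have := hb.2.2.2
          have := h1.2
          omega
        have hrev : [d', b'] <:+: (b :: Y).reverse ↔ [b', d'] <:+: b :: Y := by
          rw [← List.reverse_infix]; simp
        rw [hrev]
        obtain ⟨Z₁, Z₂, hZ⟩ := h3
        have hZ' : (Z₁ ++ [b']) ++ (d' :: Z₂) = (X ++ [d]) ++ b :: Y := by rw [← hZ]; simp
        rcases List.append_eq_append_iff.1 hZ' with ⟨W, e1, e2⟩ | ⟨W, e1, e2⟩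
        · cases W with
          | nil =>
            -- the segment `d b` itself does not pierce the new ear
            rw [List.append_nil] at e1
            have := congrArg List.getLast? e1
            simp at this
            exact absurd this.symm hb'd
          | cons w W =>
            simp only [List.cons_append, List.cons.injEq] at e2
            obtain ⟨rfl, e2⟩ := e2
            exact Or.inl ⟨Z₁, W, by rw [e1]; simp⟩
        · cases W using List.reverseRecOn with
          | nil =>
            rw [List.append_nil] at e1
            have := congrArg List.getLast? e1
            simp at this
            exact absurd this hb'd
          | append_singleton W w =>
            rw [← List.append_assoc] at e1
            have := List.append_inj_right' e1 rfl
            simp only [List.cons.injEq, and_true] at this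
            subst this
            exact Or.inr ⟨W, Z₂, by rw [e2]; simp⟩
  · push Not at hH
    refine (Ear.winTo_cycle_one hf hG hP hA hE hl fun b d h => ?_).mono (by norm_num)
    exact (hdir b d h).resolve_right (hH b d h)

lemma removalValue_cycle_le (hC : ConvexPosition C) (hP : GeneralPosition P) (hCP : C ⊆ P) :
    removalValue (PartState .cycle P col n C B) ≤ (n * 3 : ℕ) := by
  refine removalValue_le_of_rounds fun A hA hX => ?_
  have hG := hP.mono hCP
  obtain ⟨f, hf⟩ := exists_hullOrder hC hG
  obtain ⟨a, c, hE⟩ := exists_ear hf hG hA.chordsIn hX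
  exact Ear.winTo_cycle_three hf hG hP hA hE

end

/-! ### Segments at an additional point -/

section

variable {C : Finset Pt} {f : Pt → ℕ}

/-- If `q p` crosses `c d`, then `q` lies beyond `c d` as seen from `p`. -/
lemma Cross.barycentric {q p c d : Pt} (h : Cross s(q, p) s(c, d)) :
    ∃ α β γ : ℝ, α < 0 ∧ 0 < β ∧ 0 < γ ∧ α + β + γ = 1 ∧ q = α • p + β • c + γ • d := by
  obtain ⟨s, r, hs0, hs1, hr0, hr1, he⟩ := h.exists_point
  have h1 : 0 < 1 - s := by linarith
  have h2 : 0 < 1 - r := by linarith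
  refine ⟨-(s / (1 - s)), (1 - r) / (1 - s), r / (1 - s), ?_, by positivity, by positivity, ?_, ?_⟩
  · rw [neg_lt_zero]; positivity
  · field_simp; ring
  · have e1 := congrArg Prod.fst he
    have e2 := congrArg Prod.snd he
    simp only [Prod.fst_add, Prod.smul_fst, Prod.snd_add, Prod.smul_snd, smul_eq_mul] at e1 e2
    refine Prod.ext ?_ ?_
    · simp only [Prod.fst_add, Prod.smul_fst, smul_eq_mul]
      field_simp
      linarith
    · simp only [Prod.snd_add, Prod.smul_snd, smul_eq_mul]
      field_simp
      linarith

/-- In the hull order that starts at `p`, a chord whose interval contains the one of a chord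
crossing `q p` crosses `q p`, too. -/
lemma HullOrder.cross_of_interval_subset (hf : HullOrder C f) {q p c d u v : Pt} (hp : p ∈ C)
    (hc : c ∈ C) (hd : d ∈ C) (hu : u ∈ C) (hv : v ∈ C) (h : Cross s(q, p) s(c, d))
    (hpu : f p < f u) (huc : f u ≤ f c) (hcd : f c < f d) (hdv : f d ≤ f v) :
    Cross s(q, p) s(u, v) := by
  obtain ⟨α, β, γ, hα, hβ, hγ, hsum, hq⟩ := h.barycentric
  have le : ∀ {x y z}, x ∈ C → y ∈ C → z ∈ C → f x < f y → f y ≤ f z → 0 ≤ orient x y z := by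
    intro x y z hx hy hz h1 h2
    rcases h2.lt_or_eq with h2 | h2
    · exact (hf.pos x hx y hy z hz h1 h2).le
    · rw [hf.inj y hy z hz h2, orient_self_right]
  have a1 : orient p u q = α * orient p u p + β * orient p u c + γ * orient p u d :=
    orient_affine hsum hq
  have a2 : orient p v q = α * orient p v p + β * orient p v c + γ * orient p v d :=
    orient_affine hsum hq
  have a3 : orient u v q = α * orient u v p + β * orient u v c + γ * orient u v d :=
    orient_affine hsum hq
  rw [orient_self_left, mul_zero, zero_add] at a1 a2
  have o1 : 0 ≤ orient p u c := le hp hu hc hpu huc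
  have o2 : 0 < orient p u d := hf.pos p hp u hu d hd hpu (by omega)
  have o3 : 0 < orient p c v := hf.pos p hp c hc v hv (by omega) (by omega)
  have o4 : 0 ≤ orient p d v := le hp hd hv (by omega) hdv
  have o5 : 0 < orient p u v := hf.pos p hp u hu v hv hpu (by omega)
  have o6 : 0 ≤ orient v u c := by
    rcases huc.lt_or_eq with h | h
    · rw [orient_rotate c v u, orient_rotate u c v]
      exact (hf.pos u hu c hc v hv h (by omega)).le
    · rw [hf.inj u hu c hc h, orient_self_right]
  have o7 : 0 ≤ orient v u d := by
    rcases hdv.lt_or_eq with h | h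
    · rw [orient_rotate d v u, orient_rotate u d v]
      exact (hf.pos u hu d hd v hv (by omega) h).le
    · rw [hf.inj d hd v hv h, orient_self_left]
  have s1 : orient p c v = -orient p v c := by unfold orient; ring
  have s2 : orient p d v = -orient p v d := by unfold orient; ring
  have s3 : orient v u c = -orient u v c := by unfold orient; ring
  have s4 : orient v u d = -orient u v d := by unfold orient; ring
  have s5 : orient q p u = orient p u q := by unfold orient; ring
  have s6 : orient q p v = orient p v q := by unfold orient; ring
  have s7 : orient u v p = orient p u v := by unfold orient; ring
  have n1 : 0 < orient p u q := by
    have := mul_nonneg hβ.le o1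
    have := mul_pos hγ o2
    linarith
  have n2 : orient p v q < 0 := by
    have := mul_neg_of_pos_of_neg hβ (show orient p v c < 0 by linarith)
    have := mul_nonpos_of_nonneg_of_nonpos hγ.le (show orient p v d ≤ 0 by linarith)
    linarith
  have n3 : orient u v q < 0 := by
    have := mul_neg_of_neg_of_pos hα (show 0 < orient u v p by linarith)
    have := mul_nonpos_of_nonneg_of_nonpos hβ.le (show orient u v c ≤ 0 by linarith)
    have := mul_nonpos_of_nonneg_of_nonpos hγ.le (show orient u v d ≤ 0 by linarith)
    linarith
  refine cross_of_orient ?_ ?_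
  · rw [s5, s6]; exact mul_neg_of_pos_of_neg n1 n2
  · rw [s7]; exact mul_neg_of_neg_of_pos n3 o5

/-- If the chords of `A` do not cross each other, then for every segment `q p` that crosses some of
them there is a crossing chord `c d`, the nearest one to `p`, such that no chord of `A` crosses
`p c` or `p d`. -/
lemma exists_nearest_chord (hC : ConvexPosition C) (hG : GeneralPosition C) {q p : Pt}
    (hp : p ∈ C) {A : Multiset Seg} (hA : ChordsIn C A) (hfree : ∀ s ∈ A, ∀ s' ∈ A, ¬ Cross s s')
    (hX : ∃ s ∈ A, Cross s(q, p) s) :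
    ∃ c d, s(c, d) ∈ A ∧ Cross s(q, p) s(c, d) ∧
      (∀ s ∈ A, ¬ Cross s(p, c) s) ∧ ∀ s ∈ A, ¬ Cross s(p, d) s := by
  classical
  obtain ⟨f, hf, hp0⟩ := exists_hullOrder_of_mem hC hG hp
  -- minimizing `k` maximizes the interval of the hull order spanned by `c d`
  have hex : ∃ k c d, s(c, d) ∈ A ∧ Cross s(q, p) s(c, d) ∧ f c < f d ∧
      (C.sup f) - (f d - f c) = k := by
    obtain ⟨s, hs, hX⟩ := hX
    induction s using Sym2.ind with
    | _ c d =>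
      rcases (hf.ne (hA.left hs) (hA.right hs) hX.ne.2.1).lt_or_gt with h | h
      · exact ⟨_, c, d, hs, hX, h, rfl⟩
      · rw [Sym2.eq_swap (a := c)] at hs hX
        exact ⟨_, d, c, hs, hX, h, rfl⟩
  obtain ⟨c, d, h1, h2, h3, h4⟩ := Nat.find_spec hex
  have hc := hA.left h1
  have hd := hA.right h1
  have hpc := hf.ne hp hc h2.ne.2.2.2.2.1
  -- a chord whose interval strictly contains that of `c d` contradicts the choice of `c d`
  have key : ∀ u v, s(u, v) ∈ A → f p < f u → f u ≤ f c → f d ≤ f v →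
      ¬ (f u < f c ∨ f d < f v) := by
    intro u v huv e1 e2 e3 e4
    have hle := Finset.le_sup (f := f) (hA.right huv)
    refine Nat.find_min hex (m := C.sup f - (f v - f u)) (by omega) ⟨u, v, huv, ?_, by omega, rfl⟩
    exact hf.cross_of_interval_subset hp hc hd (hA.left huv) (hA.right huv) h2 e1 e2 h3 e3
  have main : ∀ w, (w = c ∨ w = d) → ∀ s ∈ A, ¬ Cross s(p, w) s := by
    intro w hw s hs hXs
    induction s using Sym2.ind with
    | _ u v =>
      wlog huv : f u < f v generalizing u v
      · rcases (not_lt.1 huv).lt_or_eq with h | h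
        · rw [Sym2.eq_swap (a := u)] at hs hXs
          exact this v u hs hXs h
        · exact absurd (hf.inj v (hA.right hs) u (hA.left hs) h) (Ne.symm hXs.ne.2.1)
      have hn := hfree _ h1 _ hs
      have hwC : w ∈ C := by rcases hw with rfl | rfl <;> assumption
      rw [hf.cross_iff hG hc hd (hA.left hs) (hA.right hs)] at hn
      rw [hf.cross_iff hG hp hwC (hA.left hs) (hA.right hs)] at hXs
      have hk := key u v hs
      unfold Alt Btw Out at hn hXs
      rcases hw with rfl | rfl <;> omega
  exact ⟨c, d, h1, h2, main c (Or.inl rfl), main d (Or.inr rfl)⟩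

/-- The line through the segment `s` strictly separates `q` from the other endpoint of `e`. -/
def Separates (q : Pt) (e s : Seg) : Prop :=
  ∃ y u v, e = s(q, y) ∧ s = s(u, v) ∧ orient u v q * orient u v y < 0

lemma separates_iff {q y u v : Pt} :
    Separates q s(q, y) s(u, v) ↔ orient u v q * orient u v y < 0 := by
  constructor
  · rintro ⟨y', u', v', h1, h2, h3⟩
    obtain rfl := Sym2.congr_right.1 h1
    rcases Sym2.eq_iff.1 h2 with ⟨rfl, rfl⟩ | ⟨rfl, rfl⟩
    · exact h3
    · rwa [orient_swap u v, orient_swap u v, neg_mul_neg] at h3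
  · intro h
    exact ⟨y, u, v, rfl, rfl, h⟩

open Classical in
/-- The number of pairs of a segment `e` of `B` at `q` and a segment `s` of `A` such that the line
through `s` separates the endpoints of `e`. -/
noncomputable def separations (q : Pt) (A B : Multiset Seg) : ℕ :=
  (B.map (fun e => Multiset.card (A.filter (Separates q e)))).sum

lemma separations_le (q : Pt) (A B : Multiset Seg) :
    separations q A B ≤ Multiset.card B * Multiset.card A := by
  classical
  unfold separations
  have := Multiset.sum_le_card_nsmul
    (B.map (fun e => Multiset.card (A.filter (Separates q e)))) (Multiset.card A) ?_
  · simpa using this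
  · intro x hx
    obtain ⟨e, -, rfl⟩ := Multiset.mem_map.1 hx
    exact Multiset.card_le_card (Multiset.filter_le _ _)

/-- Flipping a segment `q p` with a chord `c d` that crosses no other chord decreases the number of
separations. -/
lemma separations_flip_lt (hf : HullOrder C f) (hG : GeneralPosition C) {q p c d : Pt}
    (hp : p ∈ C) (hc : c ∈ C) (hd : d ∈ C) (hX : Cross s(q, p) s(c, d)) {A B : Multiset Seg}
    (hA : ChordsIn C A) (hfree : ∀ s ∈ A, ¬ Cross s s(c, d))
    (hB : ∀ e ∈ B, ∃ y ∈ C, e = s(q, y)) :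
    separations q (s(p, d) ::ₘ A) (s(q, c) ::ₘ B) <
      separations q (s(c, d) ::ₘ A) (s(q, p) ::ₘ B) := by
  classical
  obtain ⟨α, β, γ, hα, hβ, hγ, hsum, hq⟩ := hX.barycentric
  obtain ⟨-, hcd, -, -, hpc, hpd⟩ := hX.ne
  have hne : orient c d p ≠ 0 := hG.orient_ne_zero hc hd hp hcd hpd.symm hpc.symm
  have e1 : orient c d q = α * orient c d p := by
    rw [orient_affine hsum hq, orient_self_left, orient_self_right]; ring
  have e2 : orient p d q = β * orient p d c := by
    rw [orient_affine hsum hq, orient_self_left, orient_self_right]; ring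
  unfold separations
  rw [Multiset.map_cons, Multiset.map_cons, Multiset.sum_cons, Multiset.sum_cons]
  refine Nat.add_lt_add_of_lt_of_le ?_ (Multiset.sum_map_le_sum_map _ _ fun e he => ?_)
  · have h1 : ¬ Separates q s(q, c) s(p, d) := by
      rw [separates_iff, e2, not_lt]
      have : β * orient p d c * orient p d c = β * (orient p d c) ^ 2 := by ring
      rw [this]; positivity
    have h2 : Separates q s(q, p) s(c, d) := by
      rw [separates_iff, e1]
      have : α * orient c d p * orient c d p = α * (orient c d p) ^ 2 := by ring
      rw [this]
      exact mul_neg_of_neg_of_pos hα (by positivity)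
    rw [Multiset.filter_cons_of_neg _ h1, Multiset.filter_cons_of_pos _ h2, Multiset.card_cons,
      Nat.lt_succ_iff]
    apply Multiset.card_le_card
    rw [Multiset.le_filter]
    refine ⟨Multiset.filter_le _ _, fun s hs => ?_⟩
    rw [Multiset.mem_filter] at hs
    obtain ⟨hsA, hs⟩ := hs
    induction s using Sym2.ind with
    | _ u v =>
      rw [separates_iff] at hs ⊢
      have hn := hfree _ hsA
      rw [hf.cross_iff hG (hA.left hsA) (hA.right hsA) hc hd,
        ← hf.orient_mul_neg_iff (hA.left hsA) (hA.right hsA) hc hd, not_lt] at hn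
      have e3 : orient u v q = α * orient u v p + β * orient u v c + γ * orient u v d :=
        orient_affine hsum hq
      rcases mul_neg_iff.1 hs with ⟨x1, x2⟩ | ⟨x1, x2⟩
      · refine mul_neg_of_pos_of_neg x1 ?_
        have x3 : orient u v d ≤ 0 := by
          by_contra hcon
          have := mul_neg_of_neg_of_pos x2 (not_le.1 hcon)
          linarith
        have := mul_neg_of_pos_of_neg hβ x2
        have := mul_nonpos_of_nonneg_of_nonpos hγ.le x3
        by_contra hcon
        have := mul_nonpos_of_nonpos_of_nonneg hα.le (not_lt.1 hcon)
        linarith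
      · refine mul_neg_of_neg_of_pos x1 ?_
        have x3 : 0 ≤ orient u v d := by
          by_contra hcon
          have := mul_neg_of_pos_of_neg x2 (not_le.1 hcon)
          linarith
        have := mul_pos hβ x2
        have := mul_nonneg hγ.le x3
        by_contra hcon
        have := mul_nonneg_of_nonpos_of_nonpos hα.le (not_lt.1 hcon)
        linarith
  · obtain ⟨y, hy, rfl⟩ := hB e he
    have h1 : Separates q s(q, y) s(p, d) → Separates q s(q, y) s(c, d) := by
      rw [separates_iff, separates_iff, e1, e2]
      intro h
      have h' : orient p d c * orient p d y < 0 := by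
        by_contra hcon
        have := mul_nonneg hβ.le (not_lt.1 hcon)
        linarith
      rw [hf.orient_mul_neg_iff hp hd hc hy] at h'
      have hn : ¬ orient c d p * orient c d y < 0 := by
        rw [hf.orient_mul_neg_iff hc hd hp hy]
        unfold Alt Btw Out at *
        omega
      have hyc : y ≠ c := by rintro rfl; unfold Alt Btw Out at h'; omega
      have hyd : y ≠ d := by rintro rfl; unfold Alt Btw Out at h'; omega
      have hne' : orient c d y ≠ 0 := hG.orient_ne_zero hc hd hy hcd hyd.symm hyc.symm
      have hpos : 0 < orient c d p * orient c d y :=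
        lt_of_le_of_ne (not_lt.1 hn) (mul_ne_zero hne hne').symm
      rw [mul_assoc]
      exact mul_neg_of_neg_of_pos hα hpos
    by_cases h2 : Separates q s(q, y) s(p, d)
    · rw [Multiset.filter_cons_of_pos _ h2, Multiset.filter_cons_of_pos _ (h1 h2),
        Multiset.card_cons, Multiset.card_cons]
    · rw [Multiset.filter_cons_of_neg _ h2]
      exact Multiset.card_le_card (Multiset.filter_le_filter _ (Multiset.le_cons_self _ _))

end

/-! ### Parts that have the property themselves -/

section

variable {C : Finset Pt} {q : Pt} {col : Pt → Bool} {n : ℕ} {B : Multiset Seg}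

lemma degree_eq_zero_iff {p : Pt} {S : Multiset Seg} : degree p S = 0 ↔ ∀ s ∈ S, p ∉ s := by
  classical
  unfold degree
  rw [Multiset.card_eq_zero, Multiset.filter_eq_nil]

lemma removalValue_le_convexR {Γ : GraphProperty} {Q : Finset Pt} (hQ : ConvexPosition Q) {m n : ℕ}
    (hmn : m ≤ n) : removalValue (IsState Γ Q col m) ≤ convexR Γ n :=
  le_iSup₂_of_le m hmn (le_iSup₂_of_le Q hQ (le_iSup_of_le col le_rfl))

lemma removalValue_le_convexPartR {Γ : GraphProperty} {P : Finset Pt} (hP : GeneralPosition P)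
    (hC : ConvexPosition C) (hCP : C ⊆ P) :
    removalValue (PartState Γ P col n C B) ≤ convexPartR Γ n :=
  le_iSup₂_of_le n le_rfl (le_iSup₂_of_le P hP (le_iSup₂_of_le col C
    (le_iSup₂_of_le hCP hC (le_iSup_of_le B le_rfl))))

lemma partState_iff {Γ : GraphProperty} (hB : SegsIn (insert q C) B) {A : Multiset Seg} :
    PartState Γ (insert q C) col n C B A ↔
      Multiset.card A + Multiset.card B = n ∧ SegsIn C A ∧
        Satisfies (insert q C) col (A + B) Γ := by
  unfold PartState IsState
  rw [Multiset.card_add]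
  constructor
  · rintro ⟨⟨h1, h2, h3⟩, h4⟩
    exact ⟨h1, fun s hs => ⟨(h2 s (by simp [hs])).1, h4 s hs⟩, h3⟩
  · rintro ⟨h1, h2, h3⟩
    refine ⟨⟨h1, fun s hs => ?_, h3⟩, fun s hs => (h2 s hs).2⟩
    rcases Multiset.mem_add.1 hs with hs | hs
    · exact ⟨(h2 s hs).1, fun p hp => Finset.mem_insert_of_mem ((h2 s hs).2 p hp)⟩
    · exact hB s hs

lemma exists_eq_singleton (hB : SegsIn (insert q C) B) (hq : ∀ s ∈ B, q ∈ s)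
    (h : Multiset.card B = 1) : ∃ p ∈ C, B = {s(q, p)} := by
  obtain ⟨e, rfl⟩ := Multiset.card_eq_one.1 h
  obtain ⟨p, rfl⟩ := Sym2.mem_iff_exists.1 (hq e (by simp))
  have h1 := hB s(q, p) (by simp)
  have h2 := h1.2 p (by simp)
  rcases Finset.mem_insert.1 h2 with rfl | h2
  · exact absurd h1.1 (by simp)
  · exact ⟨p, h2, rfl⟩

/-- Without the segment at `q`, a perfect matching is a perfect matching of the points of `C` that
are not matched with `q`. -/
lemma isPerfectMatching_add_iff (hq : q ∉ C) {p : Pt} (hp : p ∈ C) {A : Multiset Seg} :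
    SegsIn C A ∧ IsPerfectMatching (insert q C) (A + {s(q, p)}) ↔
      SegsIn (C.erase p) A ∧ IsPerfectMatching (C.erase p) A := by
  classical
  have hqp : q ≠ p := by rintro rfl; exact hq hp
  have hdeg : ∀ x, degree x (A + {s(q, p)}) = degree x A + if x = q ∨ x = p then 1 else 0 := by
    intro x
    rw [degree_add, ← Multiset.cons_zero, degree_cons]
    congr 1
    simp [degree]
  constructor
  · rintro ⟨h1, h2⟩
    have h3 : degree p A = 0 := by
      have := h2 p (Finset.mem_insert_of_mem hp)
      rw [hdeg] at this
      simpa using this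
    rw [degree_eq_zero_iff] at h3
    refine ⟨fun s hs => ⟨(h1 s hs).1, fun x hx => Finset.mem_erase.2 ⟨?_, (h1 s hs).2 x hx⟩⟩, ?_⟩
    · rintro rfl; exact h3 s hs hx
    · intro x hx
      obtain ⟨hxp, hxC⟩ := Finset.mem_erase.1 hx
      have hxq : x ≠ q := by rintro rfl; exact hq hxC
      have := h2 x (Finset.mem_insert_of_mem hxC)
      rw [hdeg] at this
      simpa [hxp, hxq] using this
  · rintro ⟨h1, h2⟩
    refine ⟨fun s hs => ⟨(h1 s hs).1, fun x hx => Finset.mem_of_mem_erase ((h1 s hs).2 x hx)⟩, ?_⟩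
    intro x hx
    rw [hdeg]
    by_cases hx' : x = q ∨ x = p
    · have : degree x A = 0 := by
        rw [degree_eq_zero_iff]
        intro s hs hxs
        have := (h1 s hs).2 x hxs
        rcases hx' with rfl | rfl
        · exact hq (Finset.mem_of_mem_erase this)
        · simp at this
      simp [hx', this]
    · push Not at hx'
      have hxC : x ∈ C := (Finset.mem_insert.1 hx).resolve_left hx'.1
      rw [h2 x (Finset.mem_erase.2 ⟨hx'.2, hxC⟩)]
      simp [hx']

/-- A leaf is irrelevant for the connectedness of the other points. -/
lemma linked_add_leaf_iff (hq : q ∉ C) {p : Pt} (hp : p ∈ C) {A : Multiset Seg}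
    (hA : SegsIn C A) :
    (∀ x ∈ insert q C, ∀ y ∈ insert q C, Linked (A + {s(q, p)}) x y) ↔
      ∀ x ∈ C, ∀ y ∈ C, Linked A x y := by
  constructor
  · intro h x hx y hy
    have key : ∀ z, Linked (A + {s(q, p)}) x z →
        (z ≠ q → Linked A x z) ∧ (z = q → Linked A x p) := by
      intro z hz
      induction hz with
      | refl =>
        exact ⟨fun _ => Relation.ReflTransGen.refl, fun h => absurd (h ▸ hx) hq⟩
      | @tail u v _ huv ih =>
        simp only [Multiset.mem_add, Multiset.mem_singleton] at huv
        rcases huv with huv | huv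
        · have hu : u ≠ q := by rintro rfl; exact hq ((hA _ huv).2 _ (by simp))
          have hv : v ≠ q := by rintro rfl; exact hq ((hA _ huv).2 _ (by simp))
          exact ⟨fun _ => (ih.1 hu).trans (Linked.single huv), fun h => absurd h hv⟩
        · rcases Sym2.eq_iff.1 huv with ⟨rfl, rfl⟩ | ⟨rfl, rfl⟩
          · exact ⟨fun _ => ih.2 rfl, fun h => absurd (h ▸ hp) hq⟩
          · exact ⟨fun h => absurd rfl h, fun _ => ih.1 (by rintro rfl; exact hq hp)⟩
    exact (key y (h x (by simp [hx]) y (by simp [hy]))).1 (by rintro rfl; exact hq hy)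
  · intro h
    have key : ∀ x ∈ insert q C, Linked (A + {s(q, p)}) p x := by
      intro x hx
      rcases Finset.mem_insert.1 hx with rfl | hx
      · exact (Linked.single (by simp)).symm
      · exact (h p hp x hx).mono (fun s hs => by simp [hs])
    exact fun x hx y hy => (key x hx).symm.trans (key y hy)

lemma isSpanningTree_add_leaf_iff (hq : q ∉ C) {p : Pt} (hp : p ∈ C) {A : Multiset Seg}
    (hA : SegsIn C A) :
    IsSpanningTree (insert q C) (A + {s(q, p)}) ↔ IsSpanningTree C A := by
  have hA' : SegsIn (insert q C) (A + {s(q, p)}) := by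
    intro s hs
    rcases Multiset.mem_add.1 hs with hs | hs
    · exact ⟨(hA s hs).1, fun x hx => Finset.mem_insert_of_mem ((hA s hs).2 x hx)⟩
    · rw [Multiset.mem_singleton] at hs
      subst hs
      have hqp : q ≠ p := by rintro rfl; exact hq hp
      refine ⟨by simpa using hqp, ?_⟩
      intro x hx
      rcases Sym2.mem_iff.1 hx with rfl | rfl <;> simp [hp]
  rw [isSpanningTree_iff hA', isSpanningTree_iff hA, linked_add_leaf_iff hq hp hA,
    Finset.card_insert_of_notMem hq]
  have h1 : C.Nonempty := ⟨p, hp⟩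
  have h2 : (insert q C).Nonempty := ⟨q, by simp⟩
  simp [h1, h2]

lemma card_eq_zero_of_isolated {S : Multiset Seg} (hq : q ∉ C) (hS : SegsIn (insert q C) S)
    (h : IsSpanningTree (insert q C) S) (hd : degree q S = 0) : Multiset.card S = 0 := by
  obtain ⟨⟨-, h1⟩, h2⟩ := (isSpanningTree_iff hS).1 h
  rw [degree_eq_zero_iff] at hd
  have hC : C = ∅ := by
    rw [Finset.eq_empty_iff_forall_notMem]
    intro x hx
    have := (h1 q (by simp) x (by simp [hx])).mem_of_closed (Z := {q}) ?_ rfl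
    · rw [Set.mem_singleton_iff] at this
      exact hq (this ▸ hx)
    · rintro u v huv rfl
      exact absurd (Sym2.mem_mk_left u v) (hd _ huv)
  rw [hC] at h2
  simpa using h2

/-- In these cases the chords have the property `Γ` themselves, as multigraph on `C`, or on `C`
without the point that is matched with `q`. -/
lemma removalValue_partState_le_convexR {Γ : GraphProperty} (hC : ConvexPosition C) (hq : q ∉ C)
    (hP : GeneralPosition (insert q C)) {A : Multiset Seg}
    (hAB : PartState Γ (insert q C) col n C B A) (hB : ∀ s ∈ B, q ∈ s)
    (hΓ : Γ = .multigraph ∨ Γ = .matching ∨ Γ = .redBlue ∨ Multiset.card B ≤ 1) :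
    removalValue (PartState Γ (insert q C) col n C B) ≤ convexR Γ n := by
  have hBP : SegsIn (insert q C) B := fun s hs => hAB.1.2.1 s (by simp [hs])
  have hcard := hAB.1.1
  rw [Multiset.card_add] at hcard
  have hdA : degree q A = 0 := by
    rw [degree_eq_zero_iff]
    exact fun s hs hqs => hq (hAB.2 s hs q hqs)
  have hdB : degree q B = Multiset.card B := by
    classical
    unfold degree
    rw [Multiset.filter_eq_self.2 hB]
  have hd : degree q (A + B) = Multiset.card B := by rw [degree_add, hdA, hdB, zero_add]
  cases Γ with
  | multigraph =>
    have : PartState .multigraph (insert q C) col n C B =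
        IsState .multigraph C col (n - Multiset.card B) := by
      funext A'
      rw [eq_iff_iff, partState_iff hBP]
      constructor
      · rintro ⟨h1, h2, -⟩; exact ⟨by omega, h2, trivial⟩
      · rintro ⟨h1, h2, -⟩; exact ⟨by omega, h2, trivial⟩
    rw [this]
    exact removalValue_le_convexR hC (by omega)
  | matching =>
    have h1 : Multiset.card B = 1 := by rw [← hd]; exact hAB.1.2.2 q (by simp)
    obtain ⟨p, hp, rfl⟩ := exists_eq_singleton hBP hB h1
    have : PartState .matching (insert q C) col n C {s(q, p)} =
        IsState .matching (C.erase p) col (n - 1) := by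
      funext A'
      rw [eq_iff_iff, partState_iff hBP]
      have := isPerfectMatching_add_iff hq hp (A := A')
      constructor
      · rintro ⟨h2, h3, h4⟩
        obtain ⟨h5, h6⟩ := this.1 ⟨h3, h4⟩
        exact ⟨by omega, h5, h6⟩
      · rintro ⟨h2, h3, h4⟩
        obtain ⟨h5, h6⟩ := this.2 ⟨h3, h4⟩
        exact ⟨by omega, h5, h6⟩
    rw [this]
    exact removalValue_le_convexR (hC.mono (Finset.erase_subset _ _)) (by omega)
  | redBlue =>
    have h1 : Multiset.card B = 1 := by rw [← hd]; exact hAB.1.2.2.1 q (by simp)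
    obtain ⟨p, hp, rfl⟩ := exists_eq_singleton hBP hB h1
    have hc := hAB.1.2.2.2 s(q, p) (by simp)
    have : PartState .redBlue (insert q C) col n C {s(q, p)} =
        IsState .redBlue (C.erase p) col (n - 1) := by
      funext A'
      rw [eq_iff_iff, partState_iff hBP]
      have := isPerfectMatching_add_iff hq hp (A := A')
      constructor
      · rintro ⟨h2, h3, h4, h7⟩
        obtain ⟨h5, h6⟩ := this.1 ⟨h3, h4⟩
        exact ⟨by omega, h5, h6, fun s hs => h7 s (by simp [hs])⟩
      · rintro ⟨h2, h3, h4, h7⟩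
        obtain ⟨h5, h6⟩ := this.2 ⟨h3, h4⟩
        refine ⟨by omega, h5, h6, fun s hs => ?_⟩
        rcases Multiset.mem_add.1 hs with hs | hs
        · exact h7 s hs
        · rw [Multiset.mem_singleton.1 hs]; exact hc
    rw [this]
    exact removalValue_le_convexR (hC.mono (Finset.erase_subset _ _)) (by omega)
  | cycle =>
    have h2 := two_le_degree_of_isHamCycle hAB.1.2.2 (q := q) (by simp)
    rw [hd] at h2
    rcases hΓ with h | h | h | h
    · cases h
    · cases h
    · cases h
    · omega
  | tree =>
    have h1 : Multiset.card B ≤ 1 := by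
      rcases hΓ with h | h | h | h
      · cases h
      · cases h
      · cases h
      · exact h
    rcases Nat.le_one_iff_eq_zero_or_eq_one.1 h1 with h1 | h1
    · have h0 := card_eq_zero_of_isolated hq hAB.1.2.1 hAB.1.2.2 (hd.trans h1)
      have hn : n = 0 := by rw [← hAB.1.1, h0]
      have := removalValue_le_log (Γ := .tree) (col := col) (n := n) (B := B) hC hP
        (Finset.subset_insert q C) C.card (Or.inl le_rfl)
      subst hn
      rw [Nat.zero_mul] at this
      exact this.trans (by simp)
    · obtain ⟨p, hp, rfl⟩ := exists_eq_singleton hBP hB h1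
      have : PartState .tree (insert q C) col n C {s(q, p)} = IsState .tree C col (n - 1) := by
        funext A'
        rw [eq_iff_iff, partState_iff hBP]
        constructor
        · rintro ⟨h2, h3, h4⟩
          exact ⟨by omega, h3, (isSpanningTree_add_leaf_iff hq hp h3).1 h4⟩
        · rintro ⟨h2, h3, h4⟩
          exact ⟨by omega, h3, (isSpanningTree_add_leaf_iff hq hp h3).2 h4⟩
      rw [this]
      exact removalValue_le_convexR hC (by omega)

end

/-! ### The two phases -/

section

variable {Γ : GraphProperty} {C : Finset Pt} {q : Pt} {col : Pt → Bool} {n : ℕ}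

open Classical in
/-- The segments of `S` that do not end in `q`. -/
noncomputable def chords (q : Pt) (S : Multiset Seg) : Multiset Seg := S.filter (fun s => q ∉ s)

open Classical in
/-- The segments of `S` that end in `q`. -/
noncomputable def spokes (q : Pt) (S : Multiset Seg) : Multiset Seg := S.filter (fun s => q ∈ s)

lemma mem_chords {S : Multiset Seg} {s : Seg} : s ∈ chords q S ↔ s ∈ S ∧ q ∉ s := by
  classical
  exact Multiset.mem_filter

lemma mem_spokes {S : Multiset Seg} {s : Seg} : s ∈ spokes q S ↔ s ∈ S ∧ q ∈ s := by
  classical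
  exact Multiset.mem_filter

lemma chords_add_spokes (q : Pt) (S : Multiset Seg) : chords q S + spokes q S = S := by
  classical
  rw [add_comm]
  exact Multiset.filter_add_not _ _

lemma card_spokes (q : Pt) (S : Multiset Seg) : Multiset.card (spokes q S) = degree q S := rfl

lemma chords_cons_of_notMem {s : Seg} (h : q ∉ s) (S : Multiset Seg) :
    chords q (s ::ₘ S) = s ::ₘ chords q S := by
  classical
  exact Multiset.filter_cons_of_pos _ h

lemma chords_cons_of_mem {s : Seg} (h : q ∈ s) (S : Multiset Seg) :
    chords q (s ::ₘ S) = chords q S := by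
  classical
  exact Multiset.filter_cons_of_neg _ (not_not.2 h)

lemma spokes_cons_of_notMem {s : Seg} (h : q ∉ s) (S : Multiset Seg) :
    spokes q (s ::ₘ S) = spokes q S := by
  classical
  exact Multiset.filter_cons_of_neg _ h

lemma spokes_cons_of_mem {s : Seg} (h : q ∈ s) (S : Multiset Seg) :
    spokes q (s ::ₘ S) = s ::ₘ spokes q S := by
  classical
  exact Multiset.filter_cons_of_pos _ h

lemma IsState.chordsIn {S : Multiset Seg} (h : IsState Γ (insert q C) col n S) :
    ChordsIn C (chords q S) := by
  intro s hs p hp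
  obtain ⟨h1, h2⟩ := mem_chords.1 hs
  refine (Finset.mem_insert.1 ((h.2.1 s h1).2 p hp)).resolve_left ?_
  rintro rfl
  exact h2 hp

lemma IsState.partState {S : Multiset Seg} (h : IsState Γ (insert q C) col n S) :
    PartState Γ (insert q C) col n C (spokes q S) (chords q S) :=
  ⟨by rwa [chords_add_spokes], h.chordsIn⟩

lemma IsState.exists_eq_of_mem_spokes {S : Multiset Seg} (h : IsState Γ (insert q C) col n S)
    {e : Seg} (he : e ∈ spokes q S) : ∃ y ∈ C, e = s(q, y) := by
  obtain ⟨h1, h2⟩ := mem_spokes.1 he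
  obtain ⟨y, rfl⟩ := Sym2.mem_iff_exists.1 h2
  have h3 := h.2.1 _ h1
  refine ⟨y, (Finset.mem_insert.1 (h3.2 y (by simp))).resolve_left ?_, rfl⟩
  rintro rfl
  exact h3.1 (by simp)

lemma IsState.exists_flipAt {P : Finset Pt} (hP : GeneralPosition P) {S : Multiset Seg}
    (h : IsState Γ P col n S) {e : Seg × Seg} (he : IsCrossing S e) :
    ∃ S', FlipAt (IsState Γ P col n) e S S' := by
  obtain ⟨S', h1, h2, h3⟩ := exists_flipAt_of_isCrossing (B := 0) hP (by rwa [add_zero])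
    (fun s hs => (h.2.1 s hs).2) he
  simp only [add_zero] at h1 h2
  exact ⟨S', h1.1, h2.1, h3⟩

/-- A flip of two chords is a flip of the part of the multiset that consists of the chords. -/
lemma FlipAt.partState {S S' : Multiset Seg} {e : Seg × Seg}
    (h : FlipAt (IsState Γ (insert q C) col n) e S S') (h1 : q ∉ e.1) (h2 : q ∉ e.2) :
    FlipAt (PartState Γ (insert q C) col n C (spokes q S)) e (chords q S) (chords q S') ∧
      spokes q S' = spokes q S := by
  obtain ⟨hS, hS', hX, a, b, c, d, U, e1, e2, hn, rfl, rfl⟩ := h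
  rw [e1] at h1
  rw [e2] at h2
  have h1' := h1
  have h2' := h2
  simp only [Sym2.mem_iff, not_or] at h1' h2'
  have h3 : q ∉ s(a, c) := by simp [h1'.1, h2'.1]
  have h4 : q ∉ s(b, d) := by simp [h1'.2, h2'.2]
  have hsp : spokes q (s(a, c) ::ₘ s(b, d) ::ₘ U) = spokes q (s(a, b) ::ₘ s(c, d) ::ₘ U) := by
    rw [spokes_cons_of_notMem h1, spokes_cons_of_notMem h2, spokes_cons_of_notMem h3,
      spokes_cons_of_notMem h4]
  refine ⟨⟨hS.partState, ?_, hX, a, b, c, d, chords q U, e1, e2, hn, ?_, ?_⟩, hsp⟩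
  · rw [← hsp]
    exact hS'.partState
  · rw [chords_cons_of_notMem h1, chords_cons_of_notMem h2]
  · rw [chords_cons_of_notMem h3, chords_cons_of_notMem h4]

/-- The pair `e` consists of a segment `q p` and a chord crossing it such that the chords that a
flip of this pair may insert do not cross any chord of `S`. -/
def IsNearestCrossing (C : Finset Pt) (q : Pt) (S : Multiset Seg) (e : Seg × Seg) : Prop :=
  ∃ p c d, e = (s(q, p), s(c, d)) ∧ p ∈ C ∧ s(q, p) ∈ S ∧ s(c, d) ∈ chords q S ∧
    Cross s(q, p) s(c, d) ∧ (∀ s ∈ chords q S, ¬ Cross s(p, c) s) ∧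
    ∀ s ∈ chords q S, ¬ Cross s(p, d) s

lemma exists_isNearestCrossing (hC : ConvexPosition C) (hP : GeneralPosition (insert q C))
    {S : Multiset Seg} (hS : IsState Γ (insert q C) col n S) (hfree : CrossingFree (chords q S))
    (hX : ∃ e, IsCrossing S e) : ∃ e, IsNearestCrossing C q S e := by
  have key : ∀ s₁ s₂, Cross s₁ s₂ → s₁ ∈ S → s₂ ∈ S → q ∈ s₁ →
      ∃ e, IsNearestCrossing C q S e := by
    intro s₁ s₂ hX m1 m2 hq1
    obtain ⟨p, hp, rfl⟩ := hS.exists_eq_of_mem_spokes (mem_spokes.2 ⟨m1, hq1⟩)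
    have hm2 : s₂ ∈ chords q S := mem_chords.2 ⟨m2, hX.disjoint hq1⟩
    obtain ⟨c, d, h1, h2, h3, h4⟩ := exists_nearest_chord hC (hP.mono (Finset.subset_insert q C))
      hp hS.chordsIn (fun s hs s' hs' hss' => hfree ⟨(s, s'), hss', hs, hs'⟩) ⟨s₂, hm2, hX⟩
    exact ⟨_, p, c, d, rfl, hp, m1, h1, h2, h3, h4⟩
  obtain ⟨⟨s₁, s₂⟩, hX, m1, m2⟩ := hX
  by_cases h1 : q ∈ s₁
  · exact key s₁ s₂ hX m1 m2 h1
  by_cases h2 : q ∈ s₂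
  · exact key s₂ s₁ hX.symm m2 m1 h2
  exact absurd ⟨(s₁, s₂), hX, mem_chords.2 ⟨m1, h1⟩, mem_chords.2 ⟨m2, h2⟩⟩ hfree

lemma IsNearestCrossing.isCrossing {S : Multiset Seg} {e : Seg × Seg}
    (h : IsNearestCrossing C q S e) : IsCrossing S e := by
  obtain ⟨p, c, d, rfl, -, h1, h2, h3, -⟩ := h
  exact ⟨h3, h1, (mem_chords.1 h2).1⟩

/-- Flipping a nearest crossing keeps the chords crossing-free and decreases the number of
separations. -/
lemma IsNearestCrossing.flip (hC : ConvexPosition C) (hP : GeneralPosition (insert q C))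
    {S S' : Multiset Seg} {e : Seg × Seg} (he : IsNearestCrossing C q S e)
    (hfree : CrossingFree (chords q S)) (h : FlipAt (IsState Γ (insert q C) col n) e S S') :
    CrossingFree (chords q S') ∧
      separations q (chords q S') (spokes q S') < separations q (chords q S) (spokes q S) := by
  obtain ⟨p, c, d, rfl, hp, -, hcd, -, hpc, hpd⟩ := he
  obtain ⟨hS, hS', hX, U, hU, hor⟩ := h.cases
  have hG := hP.mono (Finset.subset_insert q C)
  obtain ⟨f, hf⟩ := exists_hullOrder hC hG
  have main : ∀ c d, s(c, d) ∈ chords q S → (∀ s ∈ chords q S, ¬ Cross s(p, d) s) →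
      Cross s(q, p) s(c, d) → S = s(q, p) ::ₘ s(c, d) ::ₘ U →
      CrossingFree (chords q (s(q, c) ::ₘ s(p, d) ::ₘ U)) ∧
      separations q (chords q (s(q, c) ::ₘ s(p, d) ::ₘ U))
        (spokes q (s(q, c) ::ₘ s(p, d) ::ₘ U)) < separations q (chords q S) (spokes q S) := by
    intro c d hcd hpd hX hU
    obtain ⟨hqp, -, hqc, hqd, -, -⟩ := hX.ne
    have h1 : q ∉ s(p, d) := by simp [hqp, hqd]
    have h2 : q ∉ s(c, d) := by simp [hqc, hqd]
    have e1 : chords q S = s(c, d) ::ₘ chords q U := by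
      rw [hU, chords_cons_of_mem (by simp), chords_cons_of_notMem h2]
    have e2 : spokes q S = s(q, p) ::ₘ spokes q U := by
      rw [hU, spokes_cons_of_mem (by simp), spokes_cons_of_notMem h2]
    have e3 : chords q (s(q, c) ::ₘ s(p, d) ::ₘ U) = s(p, d) ::ₘ chords q U := by
      rw [chords_cons_of_mem (by simp), chords_cons_of_notMem h1]
    have e4 : spokes q (s(q, c) ::ₘ s(p, d) ::ₘ U) = s(q, c) ::ₘ spokes q U := by
      rw [spokes_cons_of_mem (by simp), spokes_cons_of_notMem h1]
    have hA := hS.chordsIn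
    rw [e3, e4]
    constructor
    · rintro ⟨⟨s₁, s₂⟩, hX', m1, m2⟩
      simp only [Multiset.mem_cons] at m1 m2 hX'
      rcases m1 with rfl | m1 <;> rcases m2 with rfl | m2
      · exact not_cross_self _ hX'
      · exact hpd s₂ (by simp [e1, m2]) hX'
      · exact hpd s₁ (by simp [e1, m1]) hX'.symm
      · exact hfree ⟨(s₁, s₂), hX', by simp [e1, m1], by simp [e1, m2]⟩
    · rw [e1, e2]
      refine separations_flip_lt hf hG hp (hA.left hcd) (hA.right hcd) hX ?_ ?_ ?_
      · exact fun s hs => hA s (by simp [e1, hs])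
      · exact fun s hs hXs => hfree ⟨(s, s(c, d)), hXs, by simp [e1, hs], hcd⟩
      · exact fun e he => hS.exists_eq_of_mem_spokes (by simp [e2, he])
  rcases hor with rfl | rfl
  · exact main c d hcd hpd hX hU
  · rw [Sym2.eq_swap (a := c)] at hcd hX hU
    exact main d c hcd hpc hX hU

/-- A removal strategy that untangles the chords by an optimal strategy and then always removes a
nearest crossing. -/
lemma exists_two_phase_strategy (hC : ConvexPosition C) (hP : GeneralPosition (insert q C)) :
    ∃ ρ, IsRemovalStrategy (IsState Γ (insert q C) col n) ρ ∧
      ∀ S, IsState Γ (insert q C) col n S → ∀ k,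
        HasFlipSeq (IsState Γ (insert q C) col n) ρ S k →
        (CrossingFree (chords q S) → k ≤ degree q S * (n - 1)) ∧
        ∃ j : ℕ, (j : ℕ∞) ≤ removalValue (PartState Γ (insert q C) col n C (spokes q S)) ∧
          k ≤ j + degree q S * (n - 1) := by
  classical
  have hopt : ∀ B, ∃ ρ, IsRemovalStrategy (PartState Γ (insert q C) col n C B) ρ ∧
      longest (PartState Γ (insert q C) col n C B) ρ =
        removalValue (PartState Γ (insert q C) col n C B) := by
    intro B
    apply exists_optimal_strategy
    have : ∀ A, ∃ e, (∃ e, IsCrossing A e) → IsCrossing A e := by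
      intro A
      by_cases h : ∃ e, IsCrossing A e
      · obtain ⟨e, he⟩ := h; exact ⟨e, fun _ => he⟩
      · exact ⟨(s(0, 0), s(0, 0)), fun h' => absurd h' h⟩
    choose ρ hρ using this
    exact ⟨ρ, fun A hA hX => ⟨hρ A hX, PartState.exists_flipAt hP A _ hA (hρ A hX)⟩⟩
  choose ρ₁ hρ₁ using hopt
  have hnear : ∀ S, ∃ e, (∃ e, IsNearestCrossing C q S e) → IsNearestCrossing C q S e := by
    intro S
    by_cases h : ∃ e, IsNearestCrossing C q S e
    · obtain ⟨e, he⟩ := h; exact ⟨e, fun _ => he⟩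
    · exact ⟨(s(0, 0), s(0, 0)), fun h' => absurd h' h⟩
  choose ρ₂ hρ₂ using hnear
  let ρ : Multiset Seg → Seg × Seg := fun S =>
    if CrossingFree (chords q S) then ρ₂ S else ρ₁ (spokes q S) (chords q S)
  have hρ_free : ∀ S, CrossingFree (chords q S) → ρ S = ρ₂ S := fun S h => if_pos h
  have hρ_cross : ∀ S, ¬ CrossingFree (chords q S) → ρ S = ρ₁ (spokes q S) (chords q S) :=
    fun S h => if_neg h
  have hchord : ∀ S, IsState Γ (insert q C) col n S → ¬ CrossingFree (chords q S) →
      IsCrossing (chords q S) (ρ S) := by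
    intro S hS hX
    rw [hρ_cross S hX]
    exact ((hρ₁ (spokes q S)).1 _ hS.partState (not_not.1 hX)).1
  have hcr : ∀ S, IsState Γ (insert q C) col n S → (∃ e, IsCrossing S e) →
      IsCrossing S (ρ S) := by
    intro S hS hX
    by_cases h : CrossingFree (chords q S)
    · rw [hρ_free S h]
      exact (hρ₂ S (exists_isNearestCrossing hC hP hS h hX)).isCrossing
    · obtain ⟨h1, h2, h3⟩ := hchord S hS h
      exact ⟨h1, (mem_chords.1 h2).1, (mem_chords.1 h3).1⟩
  have phase₂ : ∀ k S, CrossingFree (chords q S) →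
      HasFlipSeq (IsState Γ (insert q C) col n) ρ S k →
      k ≤ separations q (chords q S) (spokes q S) := by
    intro k
    induction k with
    | zero => intros; omega
    | succ k ih =>
      intro S hfree hk
      obtain ⟨S', h1, h2⟩ := hasFlipSeq_succ_iff.1 hk
      have hne := exists_isNearestCrossing hC hP h1.1 hfree ⟨_, h1.isCrossing⟩
      rw [hρ_free S hfree] at h1
      obtain ⟨h3, h4⟩ := (hρ₂ S hne).flip hC hP hfree h1
      have := ih S' h3 h2
      omega
  have bound₂ : ∀ k S, IsState Γ (insert q C) col n S → CrossingFree (chords q S) →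
      HasFlipSeq (IsState Γ (insert q C) col n) ρ S k → k ≤ degree q S * (n - 1) := by
    intro k S hS hfree hk
    refine ((phase₂ k S hfree hk).trans (separations_le _ _ _)).trans ?_
    rw [card_spokes]
    rcases Nat.eq_zero_or_pos (degree q S) with h0 | h0
    · rw [h0, Nat.zero_mul, Nat.zero_mul]
    · refine Nat.mul_le_mul_left _ ?_
      have h1 := congrArg Multiset.card (chords_add_spokes q S)
      rw [Multiset.card_add, card_spokes, hS.1] at h1
      omega
  have bound₁ : ∀ k S, IsState Γ (insert q C) col n S →
      HasFlipSeq (IsState Γ (insert q C) col n) ρ S k →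
      ∃ j, HasFlipSeq (PartState Γ (insert q C) col n C (spokes q S)) (ρ₁ (spokes q S))
        (chords q S) j ∧ k ≤ j + degree q S * (n - 1) := by
    intro k
    induction k with
    | zero => intro S _ _; exact ⟨0, hasFlipSeq_zero _ _ _, by omega⟩
    | succ k ih =>
      intro S hS hk
      by_cases hfree : CrossingFree (chords q S)
      · exact ⟨0, hasFlipSeq_zero _ _ _, by have := bound₂ _ S hS hfree hk; omega⟩
      · obtain ⟨S', h1, h2⟩ := hasFlipSeq_succ_iff.1 hk
        obtain ⟨-, h3, h4⟩ := hchord S hS hfree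
        obtain ⟨h5, h6⟩ := h1.partState (mem_chords.1 h3).2 (mem_chords.1 h4).2
        obtain ⟨j, h7, h8⟩ := ih S' h1.2.1 h2
        rw [h6] at h7
        rw [hρ_cross S hfree] at h5
        rw [← card_spokes, h6, card_spokes] at h8
        exact ⟨j + 1, hasFlipSeq_succ_iff.2 ⟨_, h5, h7⟩, by omega⟩
  refine ⟨ρ, fun S hS hX => ⟨hcr S hS hX, hS.exists_flipAt hP (hcr S hS hX)⟩, ?_⟩
  intro S hS k hk
  refine ⟨fun hfree => bound₂ k S hS hfree hk, ?_⟩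
  obtain ⟨j, h1, h2⟩ := bound₁ k S hS hk
  refine ⟨j, ?_, h2⟩
  rw [← (hρ₁ (spokes q S)).2]
  exact h1.le_longest hS.partState

lemma natLog_add_one_le (m : ℕ) : ((Nat.log 2 m + 1 : ℕ) : ℝ) ≤ 4 * Real.log (2 + m) := by
  have h1 : (Nat.log 2 m : ℝ) ≤ Real.logb 2 m := by exact_mod_cast Real.natLog_le_logb m 2
  have h2 : (1 / 2 : ℝ) < Real.log 2 := by have := Real.log_two_gt_d9; linarith
  have hm : (0 : ℝ) ≤ m := Nat.cast_nonneg m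
  have h3 : Real.log 2 ≤ Real.log (2 + m) := Real.log_le_log (by norm_num) (by linarith)
  have h4 : Real.log m ≤ Real.log (2 + m) := by
    rcases Nat.eq_zero_or_pos m with rfl | h
    · simp only [Nat.cast_zero, Real.log_zero, add_zero]; linarith
    · exact Real.log_le_log (by exact_mod_cast h) (by linarith)
  have h5 : Real.logb 2 m ≤ 2 * Real.log (2 + m) := by
    rw [Real.logb, div_le_iff₀ (by linarith)]
    nlinarith
  push_cast
  linarith

end

end Untangle

theorem mainTheorem5 :
    ∃ K : ℝ, ∀ (Γ : Untangle.GraphProperty) (C : Finset Untangle.Pt) (q : Untangle.Pt)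
      (col : Untangle.Pt → Bool) (n : ℕ),
      Untangle.ConvexPosition C → q ∉ C → Untangle.GeneralPosition (insert q C) →
      ∃ ρ : Multiset Untangle.Seg → Untangle.Seg × Untangle.Seg,
        Untangle.IsRemovalStrategy (Untangle.IsState Γ (insert q C) col n) ρ ∧
        ∀ S : Multiset Untangle.Seg, Untangle.IsState Γ (insert q C) col n S →
        ∀ t : ℕ, t = Untangle.degree q S →
        ∀ k : ℕ, Untangle.HasFlipSeq (Untangle.IsState Γ (insert q C) col n) ρ S k →
          -- the general bound
          (k : ℕ∞) ≤ ((t * (n - 1) : ℕ) : ℕ∞) + Untangle.convexPartR Γ n ∧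
          (Γ = .multigraph ∨ Γ = .matching ∨ Γ = .redBlue ∨ t ≤ 1 →
            (k : ℕ∞) ≤ ((t * (n - 1) : ℕ) : ℕ∞) + Untangle.convexR Γ n) ∧
          -- explicit bounds for multigraphs (and all other properties)
          (k : ℝ) ≤ K * (n * Real.log (2 + C.card) + t * n) ∧
          (k : ℝ) ≤ K * (n * Real.log (2 + n) + t * n) ∧
          -- tours and red-blue matchings
          (Γ = .cycle ∨ Γ = .redBlue → (k : ℝ) ≤ K * (t * n)) ∧
          -- no crossing between segments with both endpoints in `C`
          ((∀ s₁ ∈ S, ∀ s₂ ∈ S, (∀ p ∈ s₁, p ∈ C) → (∀ p ∈ s₂, p ∈ C) →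
              ¬ Untangle.Cross s₁ s₂) →
            k ≤ t * (n - 1)) := by
  -- a first phase of at most `3 * n ≤ 3 * (t * n)` flips and a second one of at most `t * n` flips
  refine ⟨4, fun Γ C q col n hC hq hP => ?_⟩
  have hCP := Finset.subset_insert q C
  obtain ⟨ρ, hρ, hbound⟩ := Untangle.exists_two_phase_strategy (Γ := Γ) (col := col) (n := n) hC hP
  refine ⟨ρ, hρ, ?_⟩
  rintro S hS t rfl k hk
  obtain ⟨hfree, j, hj, hkj⟩ := hbound S hS k hk
  set t := Untangle.degree q S
  have hpart := hS.partState
  have hlift : ∀ {x : ℕ∞}, Untangle.removalValue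
      (Untangle.PartState Γ (insert q C) col n C (Untangle.spokes q S)) ≤ x →
      (k : ℕ∞) ≤ ((t * (n - 1) : ℕ) : ℕ∞) + x := by
    intro x hx
    have h1 : (k : ℕ∞) ≤ ((j + t * (n - 1) : ℕ) : ℕ∞) := by exact_mod_cast hkj
    rw [Nat.cast_add, add_comm] at h1
    exact h1.trans (add_le_add le_rfl (hj.trans hx))
  have hnat : ∀ {x : ℕ}, Untangle.removalValue
      (Untangle.PartState Γ (insert q C) col n C (Untangle.spokes q S)) ≤ x →
      (k : ℝ) ≤ x + t * n := by
    intro x hx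
    have h1 : j ≤ x := by exact_mod_cast hj.trans hx
    have h2 : t * (n - 1) ≤ t * n := Nat.mul_le_mul_left _ (by omega)
    have h3 : k ≤ x + t * n := by omega
    exact_mod_cast h3
  have hlog : ∀ m : ℕ, C.card ≤ m ∨ n ≤ m → (k : ℝ) ≤ 4 * (n * Real.log (2 + m) + t * n) := by
    intro m hm
    have h1 := hnat (Untangle.removalValue_le_log hC hP hCP m hm)
    have h2 := mul_le_mul_of_nonneg_left (Untangle.natLog_add_one_le m) (Nat.cast_nonneg (α := ℝ) n)
    have h3 : (0 : ℝ) ≤ t * n := by positivity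
    rw [Nat.cast_mul] at h1
    linarith
  have hlin : 1 ≤ t → Untangle.removalValue (Untangle.PartState Γ (insert q C) col n C
      (Untangle.spokes q S)) ≤ (n * 3 : ℕ) → (k : ℝ) ≤ 4 * (t * n) := by
    intro ht h
    have h1 := hnat h
    have h2 : (n : ℝ) ≤ t * n := by
      have : (1 : ℝ) ≤ t := by exact_mod_cast ht
      nlinarith [Nat.cast_nonneg (α := ℝ) n]
    push_cast at h1
    linarith
  refine ⟨hlift (Untangle.removalValue_le_convexPartR hP hC hCP), fun hΓ => hlift ?_,
    hlog _ (Or.inl le_rfl), hlog _ (Or.inr le_rfl), ?_, fun hno => hfree ?_⟩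
  · exact Untangle.removalValue_partState_le_convexR hC hq hP hpart
      (fun s hs => (Untangle.mem_spokes.1 hs).2) hΓ
  · rintro (rfl | rfl)
    · have := Untangle.two_le_degree_of_isHamCycle hS.2.2 (q := q) (by simp)
      exact hlin (by omega) (Untangle.removalValue_cycle_le hC hP hCP)
    · have : t = 1 := hS.2.2.1 q (by simp)
      refine hlin (by omega) ((Untangle.removalValue_redBlue_le hC hP hCP).trans ?_)
      exact_mod_cast Nat.mul_le_mul_left n (by norm_num)
  · rintro ⟨⟨s₁, s₂⟩, hX, m1, m2⟩
    exact hno s₁ (Untangle.mem_chords.1 m1).1 s₂ (Untangle.mem_chords.1 m2).1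
      (hS.chordsIn s₁ m1) (hS.chordsIn s₂ m2) hX
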